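/- Throughout, $\|\cdot\|_\infty$ is the maximum norm (and the induced matrix norm), solutions are Carathéodory solutions, and $t_0\in\mathbb R$ is fixed. For $i\in\mathcal N=\{1,\dots,N\}$ consider agents $$\dot y_i=F_i(t,y_i,z_i)+\Gamma_i(t,w_i)u_i,\qquad \dot z_i=Z_i(t,z_i,y_i),\qquad w_i=W_i(y_i,z_i),$$ with $y_i,u_i\in\mathbb R^m$, $z_i\in\mathbb R^{n_i}$, $w_i\in\mathbb R^{m_i}$, coupled by $$u_i=\Gamma_i(t,w_i)^{-1}\sum_{j\in\mathcal N_i}\Big(\mu_{ij}^p\big(\nu_{ij}^p/\psi_{ij}^p(t)\big)\Big)_{p=1}^m,\qquad \nu_{ij}=y_j-y_i,$$ which is defined where $|\nu_{ij}^p|<\psi_{ij}^p(t)$ for all edges and all $p$. Assume: 1. $F_i,Z_i,\Gamma_i$ are defined for $t\ge t_0$, measurable in $t$, locally Lipschitz in $(y_i,z_i)$, respectively $w_i$, and bounded on compact sets of $(y_i,z_i)$, respectively $w_i$, uniformly in $t$; $W_i$ is locally Lipschitz. 2. $\Gamma_i(t,w)$ is invertible for all $t\ge t_0$ and $w$, and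 $\|\Gamma_i(t,w)^{-1}\|_\infty\le M_\Gamma$ for some constant $M_\Gamma$. 3. The graph $\mathcal G=(\mathcal N,\mathcal E)$ with $(j,i)\in\mathcal E\iff j\in\mathcal N_i$ is undirected and connected. 4. For every edge and $p\in\{1,\dots,m\}$: $\psi_{ij}^p=\psi_{ji}^p:[t_0,\infty)\to\mathbb R_{>0}$ is bounded and $C^1$ with bounded derivative; $\mu_{ij}^p:(-1,1)\to\mathbb R$ is continuous, $\mu_{ij}^p(r)\to\pm\infty$ as $r\to\pm1$, and $\mu_{ij}^p(-r)=-\mu_{ji}^p(r)$. 5. Let $d_{\mathcal G}$ be the diameter of $\mathcal G$ and $\Psi(t)=\max_{p}\max_{(j,i)\in\mathcal E}\psi_{ij}^p(t)$ (zero if there is nothing to maximize over). For every initial time $\tau\ge t_0$, every initial state, and all absolutely continuous inputs $e_i:[\tau,\infty)\to\mathbb R^m$ with $\|e_i(t)\|_\infty\le d_{\mathcal G}\Psi(t)$, the perturbed blended dynamics $$\dot s=\frac1N\sum_{i=1}^N F_i(t,s+e_i,z_i),\qquad \dot z_i=Z_i(t,z_i,s+e_i),\quad i\in\mathcal N,\tag{P}$$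 has a global solution. Assume moreover that (P), with state $x=(s,z_1,\dots,z_N)$ and input $e=(e_1,\dots,e_N)$, is $\delta$-ISS: for every initial time $\tau\ge t_0$, every initial state and every measurable, locally essentially bounded input it has a global solution, and there are $\beta\in\mathcal{KL}$, $\hat\gamma\in\mathcal K_\infty$, not depending on $\tau$, such that for any two such inputs $e,\hat e$ and corresponding solutions $x,\hat x$ on $[\tau,\infty)$, $$\|\hat x(t)-x(t)\|_\infty\le\beta(\|\hat x(\tau)-x(\tau)\|_\infty,t-\tau)+\hat\gamma\Big(\sup_{r\in[\tau,t)}\|\hat e(r)-e(r)\|_\infty\Big),\quad t\ge\tau .$$ Then for every decreasing $w:[0,\infty)\to(0,1]$ with $w(r)\to0$ as $r\to\infty$ there is $\gamma\in\mathcal K_\infty$ such that the following holds for all initial values $(y_i(t_0),z_i(t_0))_{i\in\mathcal N}$ with $|y_j^p(t_0)-y_i^p(t_0)|<\psi_{ij}^p(t_0)$ for all edges $(j,i)\in\mathcal E$ and all $p$. The coupled system has a solution on $[t_0,\infty)$ with these initial values, and the blended dynamics ((P) with $e\equiv0$) has a solution on $[t_0,\infty)$ with initial values $\hat s(t_0)=\frac1N\sum_i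 y_i(t_0)$, $\hat z_i(t_0)=z_i(t_0)$. All maximal solutions $(y_i,z_i)_{i}$ and $(\hat s,\hat z_1,\dots,\hat z_N)$ with these initial values are defined on $[t_0,\infty)$, and for all $i\in\mathcal N$ and $t\ge t_0$, $$\left\|\begin{bmatrix}y_i(t)\\ z_i(t)\end{bmatrix}-\begin{bmatrix}\hat s(t)\\ \hat z_i(t)\end{bmatrix}\right\|_\infty\le\gamma\Big(\sup_{r\in[t_0,t)}d_{\mathcal G}\Psi(r)\,w(t-r)\Big)+d_{\mathcal G}\Psi(t).$$ -/

import Mathlib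

open Filter Topology MeasureTheory Set

noncomputable section

namespace FunnelCoupling

/-! ### Carathéodory solutions -/

/-- `x` is a Carathéodory solution of `x' = f (t, x)` on `[a, ω)` whose graph stays in the domain
`D` of `f`: it is absolutely continuous on every compact subinterval `[a, T]` and satisfies the
equation almost everywhere. Only the values of `x` on `[a, ω)` matter. -/
structure IsSolutionOn {X : Type*} [NormedAddCommGroup X] [NormedSpace ℝ X]
    (f : ℝ → X → X) (D : Set (ℝ × X)) (a : ℝ) (ω : EReal) (x : ℝ → X) : Prop where
  mem_domain : ∀ t : ℝ, a ≤ t → (t : EReal) < ω → (t, x t) ∈ D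
  absolutelyContinuous : ∀ T : ℝ, a ≤ T → (T : EReal) < ω → AbsolutelyContinuousOnInterval x a T
  hasDerivAt : ∀ᵐ t : ℝ, a < t → (t : EReal) < ω → HasDerivAt x (f t (x t)) t

/-- `x` is a Carathéodory solution on `[a, ω)`, `a < ω ≤ ∞`, which has no proper extension to the
right. -/
structure IsMaximalSolution {X : Type*} [NormedAddCommGroup X] [NormedSpace ℝ X]
    (f : ℝ → X → X) (D : Set (ℝ × X)) (a : ℝ) (ω : EReal) (x : ℝ → X) : Prop where
  lt : (a : EReal) < ω
  isSolutionOn : IsSolutionOn f D a ω x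
  maximal : ∀ (ω' : EReal) (x' : ℝ → X), IsSolutionOn f D a ω' x' →
    (∀ t : ℝ, a ≤ t → (t : EReal) < ω → x' t = x t) → ω' ≤ ω

/-! ### Comparison functions and incremental input-to-state stability -/

/-- Class `𝒦`: continuous and strictly increasing on `[0, ∞)`, zero at zero. -/
structure ClassK (α : ℝ → ℝ) : Prop where
  continuousOn : ContinuousOn α (Ici 0)
  strictMonoOn : StrictMonoOn α (Ici 0)
  zero : α 0 = 0

/-- Class `𝒦_∞`: unbounded functions of class `𝒦`. -/
structure ClassKInfty (α : ℝ → ℝ) : Prop extends ClassK α where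
  tendsto_atTop : Tendsto α atTop atTop

/-- Class `𝒦ℒ`: `β(·, t)` is of class `𝒦` for every `t ≥ 0`, and `β(r, ·)` decreases to zero for
every `r ≥ 0`. -/
structure ClassKL (β : ℝ → ℝ → ℝ) : Prop where
  classK : ∀ t, 0 ≤ t → ClassK (fun r => β r t)
  antitoneOn : ∀ r, 0 ≤ r → AntitoneOn (β r) (Ici 0)
  tendsto_zero : ∀ r, 0 ≤ r → Tendsto (β r) atTop (𝓝 0)

/-- `u : [τ, ∞) → U` is (Lebesgue) measurable and locally essentially bounded. -/
structure IsAdmissibleInput {U : Type*} [NormedAddCommGroup U] (τ : ℝ) (u : ℝ → U) : Prop where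
  measurable : AEStronglyMeasurable u (volume.restrict (Ici τ))
  locallyBounded : ∀ T : ℝ, ∃ C : ℝ, ∀ᵐ t ∂(volume.restrict (Icc τ T)), ‖u t‖ ≤ C

/-- The system `x' = f (t, x, u)`, `t ∈ [t₀, ∞)`, is `δ`-ISS with `(β, γ)`: solutions exist globally
for every initial time `τ ≥ t₀`, every initial state and every admissible input, and any two of them
satisfy the incremental estimate. If the input difference is unbounded on `[τ, t)`, the right-hand
side of the estimate is infinite, and there is nothing to require; the supremum over the empty
interval is zero. -/
structure IsDeltaISS {X U : Type*} [NormedAddCommGroup X] [NormedSpace ℝ X] [NormedAddCommGroup U]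
    (t₀ : ℝ) (f : ℝ → X → U → X) (β : ℝ → ℝ → ℝ) (γ : ℝ → ℝ) : Prop where
  classKL : ClassKL β
  classKInfty : ClassKInfty γ
  global : ∀ τ, t₀ ≤ τ → ∀ (x₀ : X) (u : ℝ → U), IsAdmissibleInput τ u →
    ∃ x : ℝ → X, x τ = x₀ ∧ IsSolutionOn (fun t ξ => f t ξ (u t)) univ τ ⊤ x
  estimate : ∀ τ, t₀ ≤ τ → ∀ u u' : ℝ → U, IsAdmissibleInput τ u → IsAdmissibleInput τ u' →
    ∀ x x' : ℝ → X,
      IsSolutionOn (fun t ξ => f t ξ (u t)) univ τ ⊤ x →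
      IsSolutionOn (fun t ξ => f t ξ (u' t)) univ τ ⊤ x' →
      ∀ t, τ ≤ t → BddAbove ((fun s => ‖u' s - u s‖) '' Ico τ t) →
        ‖x' t - x t‖ ≤ β ‖x' τ - x τ‖ (t - τ) + γ (⨆ s : Ico τ t, ‖u' s - u s‖)

/-! ### The multi-agent system with edge-wise funnel coupling -/

/-- `ℝᵏ` with the maximum norm. -/
abbrev Vec (k : ℕ) : Type := Fin k → ℝ

/-- The data of `N` agents with outputs in `ℝᵐ`, internal states in `ℝ^(n i)` and introspective
outputs in `ℝ^(d i)`, of their communication graph, and of the coupling. The node `j` is in the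
neighbourhood `𝒩ᵢ` iff `graph.Adj i j`. -/
structure Network (N m : ℕ) (n d : Fin N → ℕ) where
  /-- the vector field `Fᵢ(t, y, z)` of the output -/
  F : (i : Fin N) → ℝ → Vec m → Vec (n i) → Vec m
  /-- the vector field `Zᵢ(t, z, y)` of the internal state -/
  Z : (i : Fin N) → ℝ → Vec (n i) → Vec m → Vec (n i)
  /-- the gain matrix `Γᵢ(t, w)` -/
  Γ : (i : Fin N) → ℝ → Vec (d i) → Matrix (Fin m) (Fin m) ℝ
  /-- the introspective output `Wᵢ(y, z)` -/
  W : (i : Fin N) → Vec m → Vec (n i) → Vec (d i)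
  /-- the (undirected) communication graph -/
  graph : SimpleGraph (Fin N)
  /-- the performance functions `ψᵢⱼᵖ(t)` -/
  ψ : Fin N → Fin N → Fin m → ℝ → ℝ
  /-- the coupling functions `μᵢⱼᵖ`, used on `(-1, 1)` only -/
  μ : Fin N → Fin N → Fin m → ℝ → ℝ

/-- The conditions on a time-dependent map `f(t, x)`, `t ≥ t₀`: measurable in `t`, locally Lipschitz
in `x`, and bounded on compact sets of `x`, uniformly in `t`. -/
structure IsRegular {E E' : Type*} [NormedAddCommGroup E] [NormedAddCommGroup E']
    (t₀ : ℝ) (f : ℝ → E → E') : Prop where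
  measurable : ∀ x, AEStronglyMeasurable (fun t => f t x) (volume.restrict (Ici t₀))
  locallyLipschitz : ∀ t, t₀ ≤ t → LocallyLipschitz (f t)
  bounded : ∀ K : Set E, IsCompact K → ∃ C : ℝ, ∀ t, t₀ ≤ t → ∀ x ∈ K, ‖f t x‖ ≤ C

namespace Network

variable {N m : ℕ} {n d : Fin N → ℕ}

/-- States `(yᵢ, zᵢ)ᵢ` of the network. -/
abbrev State (m : ℕ) (n : Fin N → ℕ) : Type := (i : Fin N) → Vec m × Vec (n i)

/-- States `(s, z₁, …, z_N)` of the blended dynamics. -/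
abbrev BlendedState (m : ℕ) (n : Fin N → ℕ) : Type := Vec m × ((i : Fin N) → Vec (n i))

/-- The edge coupling `uᵢⱼ(t, ν)`. -/
def edgeCoupling (S : Network N m n d) (i j : Fin N) (t : ℝ) (ν : Vec m) : Vec m :=
  fun p => S.μ i j p (ν p / S.ψ i j p t)

open Classical in
/-- The coupling law `uᵢ = Γᵢ(t, wᵢ)⁻¹ ∑_{j ∈ 𝒩ᵢ} uᵢⱼ(t, yⱼ - yᵢ)`, where `wᵢ = Wᵢ(yᵢ, zᵢ)`. -/
def coupling (S : Network N m n d) (t : ℝ) (x : State m n) (i : Fin N) : Vec m :=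
  (S.Γ i t (S.W i (x i).1 (x i).2))⁻¹.mulVec
    (∑ j with S.graph.Adj i j, S.edgeCoupling i j t ((x j).1 - (x i).1))

/-- The right-hand side of the network in closed loop with the coupling law. -/
def closedLoop (S : Network N m n d) (t : ℝ) (x : State m n) : State m n :=
  fun i => (S.F i t (x i).1 (x i).2
      + (S.Γ i t (S.W i (x i).1 (x i).2)).mulVec (S.coupling t x i),
    S.Z i t (x i).2 (x i).1)

/-- The set of `(t, x)` at which every output difference along an edge lies inside its funnel. This
is where the coupling law, whose coupling functions live on `(-1, 1)`, is defined. -/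
def funnel (S : Network N m n d) : Set (ℝ × State m n) :=
  {q | ∀ i j, S.graph.Adj i j → ∀ p, |(q.2 j).1 p - (q.2 i).1 p| < S.ψ i j p q.1}

/-- `Ψ(t)`, the maximum over `p` and over all edges of `ψᵢⱼᵖ(t)`
(zero by convention if there is nothing to maximize over). -/
def maxFunnel (S : Network N m n d) (t : ℝ) : ℝ :=
  ⨆ q : Fin m × S.graph.Dart, S.ψ q.2.fst q.2.snd q.1 t

/-- `d_𝒢 Ψ(t)`, with `d_𝒢` the diameter of the communication graph. -/
def syncBound (S : Network N m n d) (t : ℝ) : ℝ := (S.graph.diam : ℝ) * S.maxFunnel t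

/-- The right-hand side of the perturbed blended dynamics with state `(s, z₁, …, z_N)` and input
`(e₁, …, e_N)`. -/
def perturbedBlended (S : Network N m n d) (t : ℝ) (x : BlendedState m n) (e : Fin N → Vec m) :
    BlendedState m n :=
  ((N : ℝ)⁻¹ • ∑ i, S.F i t (x.1 + e i) (x.2 i), fun i => S.Z i t (x.2 i) (x.1 + e i))

/-- The right-hand side of the blended dynamics. -/
def blended (S : Network N m n d) (t : ℝ) (x : BlendedState m n) : BlendedState m n :=
  ((N : ℝ)⁻¹ • ∑ i, S.F i t x.1 (x.2 i), fun i => S.Z i t (x.2 i) x.1)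

/-- The initial value `((1/N) ∑ yᵢ, z₁, …, z_N)` of the blended dynamics. -/
def blendedInit (x : State m n) : BlendedState m n :=
  ((N : ℝ)⁻¹ • ∑ i, (x i).1, fun i => (x i).2)

section Assumptions

attribute [local instance] Matrix.linftyOpNormedAddCommGroup

/-- Open loop dynamics. -/
structure OpenLoop (S : Network N m n d) (t₀ : ℝ) : Prop where
  F : ∀ i, IsRegular t₀ (fun t (q : Vec m × Vec (n i)) => S.F i t q.1 q.2)
  Z : ∀ i, IsRegular t₀ (fun t (q : Vec m × Vec (n i)) => S.Z i t q.2 q.1)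
  Γ : ∀ i, IsRegular t₀ (S.Γ i)
  W : ∀ i, LocallyLipschitz (fun q : Vec m × Vec (n i) => S.W i q.1 q.2)

/-- Gain matrix: invertible, with inverse uniformly bounded in the matrix norm induced by the
maximum norm. -/
structure GainMatrix (S : Network N m n d) (t₀ : ℝ) : Prop where
  isUnit : ∀ i t, t₀ ≤ t → ∀ w, IsUnit (S.Γ i t w)
  bounded : ∃ M : ℝ, 0 < M ∧ ∀ i t, t₀ ≤ t → ∀ w, ‖(S.Γ i t w)⁻¹‖ ≤ M

end Assumptions

/-- Design functions: performance functions and coupling functions of the edges. -/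
structure DesignFunctions (S : Network N m n d) (t₀ : ℝ) : Prop where
  ψ_pos : ∀ i j, S.graph.Adj i j → ∀ p t, t₀ ≤ t → 0 < S.ψ i j p t
  ψ_bounded : ∀ i j, S.graph.Adj i j → ∀ p, ∃ C : ℝ, ∀ t, t₀ ≤ t → S.ψ i j p t ≤ C
  ψ_contDiff : ∀ i j, S.graph.Adj i j → ∀ p, ContDiffOn ℝ 1 (S.ψ i j p) (Ici t₀)
  ψ_deriv_bounded : ∀ i j, S.graph.Adj i j → ∀ p, ∃ C : ℝ, ∀ t, t₀ ≤ t →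
    |derivWithin (S.ψ i j p) (Ici t₀) t| ≤ C
  ψ_symm : ∀ i j, S.graph.Adj i j → ∀ p t, t₀ ≤ t → S.ψ i j p t = S.ψ j i p t
  μ_continuousOn : ∀ i j, S.graph.Adj i j → ∀ p, ContinuousOn (S.μ i j p) (Ioo (-1) 1)
  μ_atTop : ∀ i j, S.graph.Adj i j → ∀ p, Tendsto (S.μ i j p) (𝓝[<] 1) atTop
  μ_atBot : ∀ i j, S.graph.Adj i j → ∀ p, Tendsto (S.μ i j p) (𝓝[>] (-1)) atBot
  μ_symm : ∀ i j, S.graph.Adj i j → ∀ p, ∀ r ∈ Ioo (-1 : ℝ) 1, S.μ i j p (-r) = -S.μ j i p r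

/-- No finite escape time: from every initial time and state, the perturbed blended dynamics has a
global solution for all (locally) absolutely continuous inputs bounded by `d_𝒢 Ψ`. -/
def NoFiniteEscape (S : Network N m n d) (t₀ : ℝ) : Prop :=
  ∀ τ, t₀ ≤ τ → ∀ e : ℝ → Fin N → Vec m,
    (∀ T, τ ≤ T → AbsolutelyContinuousOnInterval e τ T) →
    (∀ t, τ ≤ t → ∀ i, ‖e t i‖ ≤ S.syncBound t) →
    ∀ x₀ : BlendedState m n, ∃ x : ℝ → BlendedState m n, x τ = x₀ ∧
      IsSolutionOn (fun t ξ => S.perturbedBlended t ξ (e t)) univ τ ⊤ x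

end Network

end FunnelCoupling

end

open Filter Topology MeasureTheory Set

noncomputable section

namespace FunnelCoupling

/-! ### Absolutely continuous functions -/

section AbsolutelyContinuous

variable {X Y : Type*} [NormedAddCommGroup X] [NormedAddCommGroup Y]

/-! Let s be the mean of the outputs. The gain cancels against its inverse, and the coupling is
antisymmetric along edges, so (s, z₁, …, z_N) solves the perturbed blended dynamics with input eᵢ =
yᵢ - s (`blendedInit_closedLoop`). Inside the funnels, summing along shortest walks gives ‖eᵢ‖ ≤ d_𝒢
Ψ. Two things remain: global existence, and an estimate that discounts old values of e.

Global existence. On a finite interval [t₀, b), s and the zᵢ are restrictions of a global solution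
supplied by δ-ISS. Hence all states are bounded, the zᵢ converge at b, and each output component is
a scalar network with bounded drift. The energy ½ ∑ yᵢ² controls the integral of the total coupling
strength, so the outputs have limits at b (`exists_tendsto_of_dissipative`). Suppose the limits
touch the funnel boundary on a set K of oriented edges. There is a nonnegative combination of the
differences along K whose node weights are strictly ordered along every edge of K
(`exists_separating_potential`). The same combination of the gaps between differences and barriers
is nonpositive and tends to 0 at b, while the diverging couplings push its derivative to -∞, which
is absurd (`not_all_barriers_attained`). So the limit state lies in the funnel, and Carathéodory's
theorem (`exists_local_solution`) continues the solution past b.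

Estimate. δ-ISS is restarted at t - r for every r ≥ 0. The state difference at the restart is
uniformly bounded, and on the window [t - r, t) the input is at most v / w(r), where v is the
weighted supremum. Optimizing over r yields a function of v alone which vanishes continuously at 0
and has a `ClassKInfty` majorant (`IsDeltaISS.fading_memory`). The distance from yᵢ to s adds the
final summand d_𝒢 Ψ(t). -/

theorem absolutelyContinuous_comp_left {f : ℝ → X} {a b c d : ℝ} {φ : ℝ → ℝ}
    (hf : AbsolutelyContinuousOnInterval f a b) (hφ : Monotone φ) (hL : LipschitzWith 1 φ)
    (hm : MapsTo φ (uIcc c d) (uIcc a b)) :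
    AbsolutelyContinuousOnInterval (fun t => f (φ t)) c d := by
  rw [absolutelyContinuousOnInterval_iff] at hf ⊢
  intro ε hε
  obtain ⟨δ, hδ, h⟩ := hf ε hε
  refine ⟨δ, hδ, fun E hE hlen => ?_⟩
  refine h (E.1, fun i => (φ (E.2 i).1, φ (E.2 i).2)) ⟨?_, ?_⟩ ?_
  · intro i hi
    exact ⟨hm (hE.1 i hi).1, hm (hE.1 i hi).2⟩
  · intro i hi j hj hij
    have hd := hE.2 hi hj hij
    simp only [Function.onFun] at hd ⊢
    rw [Set.disjoint_left] at hd ⊢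
    intro p hp hq
    simp only [mem_uIoc] at hp hq hd
    -- A monotone map reflects strict inequalities, so a common point of two image intervals forces
    -- the original intervals to overlap; the smaller of their right end points is then a common
    -- point.
    have key : ∀ u v, φ u < φ v → u < v := fun u v huv => hφ.reflect_lt huv
    rcases hp with hp | hp <;> rcases hq with hq | hq
    all_goals
      have h1 := key _ _ (hp.1.trans_le hp.2)
      have h2 := key _ _ (hq.1.trans_le hq.2)
      have h3 := key _ _ (hp.1.trans_le hq.2)
      have h4 := key _ _ (hq.1.trans_le hp.2)
    · exact hd (a := min (E.2 i).2 (E.2 j).2) (Or.inl ⟨lt_min h1 h3, min_le_left _ _⟩)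
        (Or.inl ⟨lt_min h4 h2, min_le_right _ _⟩)
    · exact hd (a := min (E.2 i).2 (E.2 j).1) (Or.inl ⟨lt_min h1 h3, min_le_left _ _⟩)
        (Or.inr ⟨lt_min h4 h2, min_le_right _ _⟩)
    · exact hd (a := min (E.2 i).1 (E.2 j).2) (Or.inr ⟨lt_min h1 h3, min_le_left _ _⟩)
        (Or.inl ⟨lt_min h4 h2, min_le_right _ _⟩)
    · exact hd (a := min (E.2 i).1 (E.2 j).1) (Or.inr ⟨lt_min h1 h3, min_le_left _ _⟩)
        (Or.inr ⟨lt_min h4 h2, min_le_right _ _⟩)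
  · refine lt_of_le_of_lt (Finset.sum_le_sum fun i _ => ?_) hlen
    simpa using hL.dist_le_mul (E.2 i).1 (E.2 i).2

theorem absolutelyContinuous_congr {f g : ℝ → X} {a b : ℝ}
    (hf : AbsolutelyContinuousOnInterval f a b) (h : EqOn g f (uIcc a b)) :
    AbsolutelyContinuousOnInterval g a b := by
  rw [absolutelyContinuousOnInterval_iff] at hf ⊢
  intro ε hε
  obtain ⟨δ, hδ, hd⟩ := hf ε hε
  refine ⟨δ, hδ, fun E hE hlen => ?_⟩
  rw [Finset.sum_congr rfl fun i hi => by rw [h (hE.1 i hi).1, h (hE.1 i hi).2]]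
  exact hd E hE hlen

theorem absolutelyContinuous_comp_right {f : ℝ → X} {φ : X → Y} {K : NNReal} {a b : ℝ}
    (hf : AbsolutelyContinuousOnInterval f a b) (hφ : LipschitzWith K φ) :
    AbsolutelyContinuousOnInterval (fun t => φ (f t)) a b := by
  rw [absolutelyContinuousOnInterval_iff] at hf ⊢
  intro ε hε
  obtain ⟨δ, hδ, hd⟩ := hf (ε / (K + 1)) (by positivity)
  refine ⟨δ, hδ, fun E hE hlen => ?_⟩
  have h1 := hd E hE hlen
  rw [lt_div_iff₀ (by positivity)] at h1
  refine lt_of_le_of_lt ?_ h1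
  rw [Finset.sum_mul]
  refine Finset.sum_le_sum fun i _ => (hφ.dist_le_mul _ _).trans ?_
  nlinarith [dist_nonneg (x := f (E.2 i).1) (y := f (E.2 i).2)]

theorem absolutelyContinuous_const (c : X) (a b : ℝ) :
    AbsolutelyContinuousOnInterval (fun _ => c) a b :=
  ((LipschitzWith.const c).lipschitzOnWith (s := uIcc a b)).absolutelyContinuousOnInterval

theorem absolutelyContinuous_finset_sum {ι : Type*} (s : Finset ι) {f : ι → ℝ → X} {a b : ℝ}
    (hf : ∀ i ∈ s, AbsolutelyContinuousOnInterval (f i) a b) :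
    AbsolutelyContinuousOnInterval (fun t => ∑ i ∈ s, f i t) a b := by
  classical
  induction s using Finset.induction_on with
  | empty => simpa using absolutelyContinuous_const (0 : X) a b
  | insert i s hi ih =>
    simp only [Finset.sum_insert hi]
    exact (hf i (by simp)).add (ih fun j hj => hf j (by simp [hj]))

/-- The glued function equals f(min t b) + g(max t b) - g(b), and both reparametrizations are
monotone and 1-Lipschitz. -/
theorem absolutelyContinuous_glue {f g : ℝ → X} {a b c : ℝ} (hab : a ≤ b) (hbc : b ≤ c)
    (hf : AbsolutelyContinuousOnInterval f a b) (hg : AbsolutelyContinuousOnInterval g b c)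
    (hfg : f b = g b) :
    AbsolutelyContinuousOnInterval (fun t => if t ≤ b then f t else g t) a c := by
  have h1 : AbsolutelyContinuousOnInterval (fun t => f (min t b)) a c := by
    refine absolutelyContinuous_comp_left hf (fun x y h => min_le_min_right b h)
      (LipschitzWith.id.min_const b) fun t ht => ?_
    rw [uIcc_of_le (hab.trans hbc)] at ht
    rw [uIcc_of_le hab]
    exact ⟨le_min ht.1 hab, min_le_right _ _⟩
  have h2 : AbsolutelyContinuousOnInterval (fun t => g (max t b)) a c := by
    refine absolutelyContinuous_comp_left hg (fun x y h => max_le_max_right b h)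
      (LipschitzWith.id.max_const b) fun t ht => ?_
    rw [uIcc_of_le (hab.trans hbc)] at ht
    rw [uIcc_of_le hbc]
    exact ⟨le_max_right _ _, max_le ht.2 hbc⟩
  refine absolutelyContinuous_congr ((h1.add h2).sub (absolutelyContinuous_const (g b) a c)) ?_
  intro t _
  simp only [Pi.sub_apply, Pi.add_apply]
  split_ifs with h
  · rw [min_eq_left h, max_eq_right h]; abel
  · rw [min_eq_right (not_le.1 h).le, max_eq_left (not_le.1 h).le, hfg]; abel

/-- The fundamental theorem of calculus for the absolutely continuous function g - f, whose
derivative is nonnegative almost everywhere. -/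
theorem sub_le_of_ae_hasDerivAt_le {f g f' g' : ℝ → ℝ} {a b : ℝ} (hab : a ≤ b)
    (hf : AbsolutelyContinuousOnInterval f a b) (hg : AbsolutelyContinuousOnInterval g a b)
    (hf' : ∀ᵐ t, t ∈ Ioo a b → HasDerivAt f (f' t) t)
    (hg' : ∀ᵐ t, t ∈ Ioo a b → HasDerivAt g (g' t) t)
    (hle : ∀ᵐ t, t ∈ Ioo a b → f' t ≤ g' t) :
    f b - f a ≤ g b - g a := by
  have h := (hg.sub hf).integral_deriv_eq_sub
  have h0 : 0 ≤ ∫ t in a..b, deriv (g - f) t := by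
    refine intervalIntegral.integral_nonneg_of_ae_restrict hab ?_
    rw [Filter.EventuallyLE, ae_restrict_iff' measurableSet_Icc]
    have ha : ∀ᵐ t : ℝ, t ≠ a := by simp [ae_iff, measure_singleton]
    have hb : ∀ᵐ t : ℝ, t ≠ b := by simp [ae_iff, measure_singleton]
    filter_upwards [hf', hg', hle, ha, hb] with t h1 h2 h3 h4 h5 ht
    have ht' : t ∈ Ioo a b := ⟨lt_of_le_of_ne ht.1 (Ne.symm h4), lt_of_le_of_ne ht.2 h5⟩
    rw [((h2 ht').sub (h1 ht')).deriv]
    simpa using h3 ht'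
  rw [h] at h0
  simp only [Pi.sub_apply] at h0
  linarith

variable [NormedSpace ℝ X]

/-- A functional of norm at most one that attains the norm of the increment reduces the claim to the
scalar comparison. -/
theorem norm_sub_le_of_ae_hasDerivAt {f f' : ℝ → X} {a b M : ℝ} (hab : a ≤ b)
    (hf : AbsolutelyContinuousOnInterval f a b)
    (hf' : ∀ᵐ t, t ∈ Ioo a b → HasDerivAt f (f' t) t)
    (hM : ∀ᵐ t, t ∈ Ioo a b → ‖f' t‖ ≤ M) :
    ‖f b - f a‖ ≤ M * (b - a) := by
  obtain ⟨φ, hφ, hφ'⟩ := exists_dual_vector'' ℝ (f b - f a)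
  have h1 : AbsolutelyContinuousOnInterval (fun t => φ (f t)) a b :=
    absolutelyContinuous_comp_right hf φ.lipschitz
  have h2 : AbsolutelyContinuousOnInterval (fun t : ℝ => M * t) a b :=
    (LipschitzWith.id.lipschitzOnWith (s := uIcc a b)).absolutelyContinuousOnInterval.const_mul M
  have := sub_le_of_ae_hasDerivAt_le (f' := fun t => φ (f' t)) (g' := fun _ => M) hab h1 h2
    (by
      filter_upwards [hf'] with t ht h
      exact φ.hasFDerivAt.comp_hasDerivAt t (ht h))
    (Eventually.of_forall fun t _ => by simpa using (hasDerivAt_id t).const_mul M)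
    (by
      filter_upwards [hM] with t ht h
      calc φ (f' t) ≤ ‖φ (f' t)‖ := Real.le_norm_self _
        _ ≤ ‖φ‖ * ‖f' t‖ := φ.le_opNorm _
        _ ≤ 1 * M := mul_le_mul hφ (ht h) (norm_nonneg _) zero_le_one
        _ = M := one_mul M)
  rw [← map_sub, hφ'] at this
  simpa [mul_sub] using this

end AbsolutelyContinuous

/-! ### Gluing and restricting solutions -/

section Solutions

variable {X : Type*} [NormedAddCommGroup X] [NormedSpace ℝ X] {f : ℝ → X → X} {D : Set (ℝ × X)}
  {a : ℝ} {ω : EReal}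

theorem IsSolutionOn.restrict {x : ℝ → X} (h : IsSolutionOn f D a ω x) {b : ℝ} {ω' : EReal}
    (hab : a ≤ b) (hω : ω' ≤ ω) : IsSolutionOn f D b ω' x where
  mem_domain t ht hlt := h.mem_domain t (hab.trans ht) (hlt.trans_le hω)
  absolutelyContinuous T hT hlt :=
    (h.absolutelyContinuous T (hab.trans hT) (hlt.trans_le hω)).mono (by
      rw [uIcc_of_le hT, uIcc_of_le (hab.trans hT)]
      exact Icc_subset_Icc_left hab)
  hasDerivAt := by
    filter_upwards [h.hasDerivAt] with t ht h1 h2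
    exact ht (hab.trans_lt h1) (h2.trans_le hω)

theorem IsSolutionOn.continuousOn {x : ℝ → X} (h : IsSolutionOn f D a ω x) {T : ℝ}
    (hT : a ≤ T) (hlt : (T : EReal) < ω) : ContinuousOn x (Icc a T) := by
  have := (h.absolutelyContinuous T hT hlt).continuousOn
  rwa [uIcc_of_le hT] at this

theorem IsSolutionOn.congr_rhs {x : ℝ → X} (h : IsSolutionOn f D a ω x) {g : ℝ → X → X}
    {D' : Set (ℝ × X)} (hD : ∀ t : ℝ, a ≤ t → (t : EReal) < ω → (t, x t) ∈ D')
    (hg : ∀ t : ℝ, a < t → (t : EReal) < ω → g t (x t) = f t (x t)) :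
    IsSolutionOn g D' a ω x where
  mem_domain := hD
  absolutelyContinuous := h.absolutelyContinuous
  hasDerivAt := by
    filter_upwards [h.hasDerivAt] with t ht h1 h2
    rw [hg t h1 h2]
    exact ht h1 h2

/-- The first piece must be absolutely continuous up to and including b, which being a solution on
[a, b) does not provide; hence its properties are listed separately. The junction b is a null set
for the differential equation. -/
theorem IsSolutionOn.glue {x y : ℝ → X} {b : ℝ} (hab : a ≤ b)
    (hD : ∀ t, a ≤ t → t < b → (t, x t) ∈ D) (hac : AbsolutelyContinuousOnInterval x a b)
    (hx : ∀ᵐ t : ℝ, a < t → t < b → HasDerivAt x (f t (x t)) t)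
    (hy : IsSolutionOn f D b ω y) (hxy : x b = y b) (hb : (b : EReal) < ω) :
    IsSolutionOn f D a ω (fun t => if t ≤ b then x t else y t) where
  mem_domain t ht hlt := by
    rcases lt_trichotomy t b with h | rfl | h
    · simpa [h.le] using hD t ht h
    · simpa [hxy] using hy.mem_domain t le_rfl hb
    · simpa [h.not_ge] using hy.mem_domain t h.le hlt
  absolutelyContinuous T hT hlt := by
    rcases le_total b T with h | h
    · exact absolutelyContinuous_glue hab h hac (hy.absolutelyContinuous T h hlt) hxy
    · have h1 : uIcc a T ⊆ uIcc a b := by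
        rw [uIcc_of_le hT, uIcc_of_le hab]
        exact Icc_subset_Icc_right h
      refine absolutelyContinuous_congr (hac.mono h1) fun t ht => ?_
      rw [uIcc_of_le hT] at ht
      simp [ht.2.trans h]
  hasDerivAt := by
    have hne : ∀ᵐ t : ℝ, t ≠ b := by simp [ae_iff, measure_singleton]
    filter_upwards [hx, hy.hasDerivAt, hne] with t h1 h2 h3 hat hlt
    rcases lt_or_gt_of_ne h3 with h | h
    · simp only [h.le, if_true]
      refine (h1 hat h).congr_of_eventuallyEq ?_
      filter_upwards [Iio_mem_nhds h] with r hr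
      simp [(mem_Iio.1 hr).le]
    · simp only [h.not_ge, if_false]
      refine (h2 h hlt).congr_of_eventuallyEq ?_
      filter_upwards [Ioi_mem_nhds h] with r hr
      simp [not_le.2 (mem_Ioi.1 hr)]

end Solutions

/-! ### Comparison functions -/

theorem ClassKL.nonneg {β : ℝ → ℝ → ℝ} (h : ClassKL β) {r t : ℝ} (hr : 0 ≤ r) (ht : 0 ≤ t) :
    0 ≤ β r t := by
  have := (h.classK t ht).strictMonoOn.monotoneOn (mem_Ici.2 le_rfl) (mem_Ici.2 hr) hr
  simpa only [(h.classK t ht).zero] using this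

theorem ClassK.nonneg {α : ℝ → ℝ} (h : ClassK α) {r : ℝ} (hr : 0 ≤ r) : 0 ≤ α r := by
  have := h.strictMonoOn.monotoneOn (mem_Ici.2 le_rfl) (mem_Ici.2 hr) hr
  rwa [h.zero] at this

theorem ClassK.mono {α : ℝ → ℝ} (h : ClassK α) {r s : ℝ} (hr : 0 ≤ r) (hrs : r ≤ s) :
    α r ≤ α s :=
  h.strictMonoOn.monotoneOn (mem_Ici.2 hr) (mem_Ici.2 (hr.trans hrs)) hrs

/-- A monotone function which is continuous at zero has a majorant of class `𝒦_∞`. -/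
theorem exists_classKInfty_majorant {ρ : ℝ → ℝ} (hmono : Monotone ρ) (h0 : ρ 0 = 0)
    (hcont : ContinuousAt ρ 0) :
    ∃ γ, ClassKInfty γ ∧ ∀ v, 0 ≤ v → ρ v ≤ γ v := by
  have hmul : ∀ v : ℝ, 0 ≤ v → Monotone fun s => ρ (v * s) := fun v hv s t hst =>
    hmono (mul_le_mul_of_nonneg_left hst hv)
  have hint : ∀ v : ℝ, 0 ≤ v → IntervalIntegrable (fun s => ρ (v * s)) volume 1 2 := fun v hv =>
    (hmul v hv).intervalIntegrable
  have hge : ∀ v, 0 ≤ v → ρ v ≤ ∫ s in (1 : ℝ)..2, ρ (v * s) := by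
    intro v hv
    have h1 : ∫ _ in (1 : ℝ)..2, ρ v ≤ ∫ s in (1 : ℝ)..2, ρ (v * s) :=
      intervalIntegral.integral_mono_on (by norm_num) (by simp) (hint v hv) fun s hs =>
        hmono (le_mul_of_one_le_right hv hs.1)
    rw [intervalIntegral.integral_const] at h1
    norm_num at h1
    exact h1
  have hImono : MonotoneOn (fun v => ∫ s in (1 : ℝ)..2, ρ (v * s)) (Ici 0) := by
    intro v hv v' hv' hvv
    exact intervalIntegral.integral_mono_on (by norm_num) (hint v hv) (hint v' hv') fun s hs =>
      hmono (mul_le_mul_of_nonneg_right hvv (zero_le_one.trans hs.1))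
  -- Averaging over the scales s ∈ [1, 2] dominates ρ and smooths it: a monotone function has
  -- countably many jumps, so for v > 0 almost every s makes v * s a continuity point, and at v = 0
  -- the assumed continuity is used. The summand v gives strict growth and unboundedness.
  refine ⟨fun v => v + ∫ s in (1 : ℝ)..2, ρ (v * s), ⟨⟨?_, ?_, ?_⟩, ?_⟩, fun v hv => ?_⟩
  · refine continuousOn_id.add fun v hv => ?_
    have hv : 0 ≤ v := hv
    refine ContinuousAt.continuousWithinAt ?_
    refine intervalIntegral.continuousAt_of_dominated_interval
      (bound := fun _ => |ρ (-(2 * (v + 1)))| + |ρ (2 * (v + 1))|) ?_ ?_ (by simp) ?_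
    · refine Eventually.of_forall fun u => ?_
      exact (hmono.measurable.comp (measurable_const.mul measurable_id)).aestronglyMeasurable
    · have hI : Ioo (-1 : ℝ) (v + 1) ∈ 𝓝 v := Ioo_mem_nhds (by linarith) (by linarith)
      filter_upwards [hI] with u hu
      refine Eventually.of_forall fun s hs => ?_
      rw [uIoc_of_le (by norm_num)] at hs
      obtain ⟨hs1, hs2⟩ := hs
      obtain ⟨hu1, hu2⟩ := hu
      have e1 : ρ (-(2 * (v + 1))) ≤ ρ (u * s) := hmono (by nlinarith)
      have e2 : ρ (u * s) ≤ ρ (2 * (v + 1)) := hmono (by nlinarith)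
      rw [Real.norm_eq_abs, abs_le]
      constructor
      · linarith [neg_abs_le (ρ (-(2 * (v + 1)))), abs_nonneg (ρ (2 * (v + 1)))]
      · linarith [le_abs_self (ρ (2 * (v + 1))), abs_nonneg (ρ (-(2 * (v + 1))))]
    · rcases hv.eq_or_lt with rfl | hv
      · refine Eventually.of_forall fun s _ => ?_
        have : ContinuousAt ρ (0 * s) := by simpa using hcont
        exact this.comp (f := fun u : ℝ => u * s) (by fun_prop)
      · have hc : {r | ¬ContinuousAt ρ r}.Countable := hmono.countable_not_continuousAt
        have hc' : {s : ℝ | ¬ContinuousAt ρ (v * s)}.Countable :=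
          hc.preimage_of_injOn (f := fun s => v * s)
            ((mul_right_injective₀ hv.ne').injOn)
        filter_upwards [hc'.ae_notMem volume] with s hs _
        have : ContinuousAt ρ (v * s) := by simpa using hs
        exact this.comp (f := fun u : ℝ => u * s) (by fun_prop)
  · intro v hv v' hv' hvv
    exact add_lt_add_of_lt_of_le hvv (hImono hv hv' hvv.le)
  · simp [h0]
  · refine tendsto_atTop_mono' atTop ?_ tendsto_id
    filter_upwards [eventually_ge_atTop 0] with v hv
    have h1 : ρ 0 ≤ ρ v := hmono hv
    rw [h0] at h1
    simpa using h1.trans (hge v hv)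
  · exact (hge v hv).trans (by linarith)

/-- The infimum over h of the bounds is monotone in v. It tends to 0 with v: first choose h so large
that β(R, h) is small, then v so small that γ(v / w h) is small. A majorant of class `ClassKInfty`
therefore exists. -/
theorem exists_classKInfty_fading {β : ℝ → ℝ → ℝ} {γ : ℝ → ℝ} (hβ : ClassKL β)
    (hγ : ClassKInfty γ) {w : ℝ → ℝ} (hw : ∀ r, 0 ≤ r → w r ∈ Ioc (0 : ℝ) 1) {R : ℝ}
    (hR : 0 ≤ R) :
    ∃ γ', ClassKInfty γ' ∧ ∀ v, 0 ≤ v → ∀ q : ℝ,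
      (∀ h, 0 ≤ h → q ≤ β R h + γ (v / w h)) → q ≤ γ' v := by
  -- Truncating v at 0 makes the infimum monotone on the whole line, as the majorant construction
  -- requires.
  let B : ℝ → Ici (0 : ℝ) → ℝ := fun v h => β R h + γ (max v 0 / w h)
  have hwp : ∀ h : Ici (0 : ℝ), 0 < w h := fun h => (hw h h.2).1
  have hB : ∀ v h, 0 ≤ B v h := fun v h =>
    add_nonneg (hβ.nonneg hR h.2) (hγ.nonneg (div_nonneg (le_max_right _ _) (hwp h).le))
  have hbdd : ∀ v, BddBelow (range (B v)) := fun v => ⟨0, by rintro _ ⟨h, rfl⟩; exact hB v h⟩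
  let ρ : ℝ → ℝ := fun v => ⨅ h, B v h
  have hρnn : ∀ v, 0 ≤ ρ v := fun v => le_ciInf (hB v)
  have hmono : Monotone ρ := fun v v' hv => ciInf_mono (hbdd v) fun h =>
    add_le_add_right (hγ.mono (div_nonneg (le_max_right _ _) (hwp h).le)
      (div_le_div_of_nonneg_right (max_le_max_right 0 hv) (hwp h).le)) _
  have hlt : ∀ ε > 0, ∀ᶠ v in 𝓝 (0 : ℝ), ρ v < ε := by
    intro ε hε
    obtain ⟨h, hh0, hh⟩ := ((eventually_ge_atTop 0).and
      ((hβ.tendsto_zero R hR).eventually (gt_mem_nhds hε))).exists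
    have hc : Tendsto (fun v => B v ⟨h, hh0⟩) (𝓝 0) (𝓝 (β R h + 0)) := by
      refine tendsto_const_nhds.add ?_
      have h1 : Tendsto (fun v : ℝ => max v 0 / w h) (𝓝 0) (𝓝[Ici 0] 0) := by
        refine tendsto_nhdsWithin_iff.2 ⟨?_, Eventually.of_forall fun v =>
          mem_Ici.2 (div_nonneg (le_max_right _ _) (hw h hh0).1.le)⟩
        have : Continuous fun v : ℝ => max v 0 / w h := by fun_prop
        simpa using this.tendsto 0
      have h2 := hγ.continuousOn 0 (mem_Ici.2 le_rfl)
      rw [ContinuousWithinAt, hγ.zero] at h2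
      exact h2.comp h1
    rw [add_zero] at hc
    filter_upwards [hc.eventually (gt_mem_nhds hh)] with v hv
    exact (ciInf_le (hbdd v) ⟨h, hh0⟩).trans_lt hv
  have h0 : ρ 0 = 0 := le_antisymm
    (le_of_forall_pos_le_add fun ε hε => by simpa using ((hlt ε hε).self_of_nhds).le) (hρnn 0)
  have hcont : ContinuousAt ρ 0 := by
    rw [ContinuousAt, h0]
    refine tendsto_order.2 ⟨fun a ha => Eventually.of_forall fun v => ha.trans_le (hρnn v), hlt⟩
  obtain ⟨γ', hγ', hle⟩ := exists_classKInfty_majorant hmono h0 hcont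
  refine ⟨γ', hγ', fun v hv q hq => le_trans ?_ (hle v hv)⟩
  refine le_ciInf fun h => ?_
  simpa [B, max_eq_left hv] using hq h h.2

/-! ### Consequences of incremental input-to-state stability -/

section DeltaISS

variable {X U : Type*} [NormedAddCommGroup X] [NormedSpace ℝ X] [NormedAddCommGroup U]

theorem IsAdmissibleInput.mono {τ τ' : ℝ} {u : ℝ → U} (h : IsAdmissibleInput τ u)
    (hτ : τ ≤ τ') : IsAdmissibleInput τ' u where
  measurable := h.measurable.mono_measure (Measure.restrict_mono (Ici_subset_Ici.2 hτ) le_rfl)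
  locallyBounded T := by
    obtain ⟨C, hC⟩ := h.locallyBounded T
    exact ⟨C, ae_mono (Measure.restrict_mono (Icc_subset_Icc_left hτ) le_rfl) hC⟩

theorem isAdmissibleInput_zero (τ : ℝ) : IsAdmissibleInput τ (fun _ => (0 : U)) where
  measurable := aestronglyMeasurable_const
  locallyBounded _ := ⟨0, by simp⟩

variable {t₀ : ℝ} {f : ℝ → X → U → X} {β : ℝ → ℝ → ℝ} {γ : ℝ → ℝ}

/-- Uniqueness comes from the incremental estimate with equal inputs and equal initial states. That
estimate concerns global solutions only, so x is first continued beyond T by a global solution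
starting at x T. -/
theorem IsDeltaISS.eq_of_isSolutionOn (h : IsDeltaISS t₀ f β γ) {τ : ℝ} (hτ : t₀ ≤ τ)
    {u : ℝ → U} (hu : IsAdmissibleInput τ u) {x y : ℝ → X} {ω : EReal}
    (hx : IsSolutionOn (fun t ξ => f t ξ (u t)) univ τ ω x)
    (hy : IsSolutionOn (fun t ξ => f t ξ (u t)) univ τ ⊤ y) (hxy : x τ = y τ) {T : ℝ}
    (hT : τ ≤ T) (hTω : (T : EReal) < ω) : x T = y T := by
  obtain ⟨z, hz0, hz⟩ := h.global T (hτ.trans hT) (x T) u (hu.mono hT)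
  have hg := IsSolutionOn.glue hT (fun _ _ _ => mem_univ _) (hx.absolutelyContinuous T hT hTω)
    (by
      filter_upwards [hx.hasDerivAt] with t ht h1 h2
      exact ht h1 ((EReal.coe_lt_coe h2).trans hTω)) hz hz0.symm (EReal.coe_lt_top T)
  have he := h.estimate τ hτ u u hu hu y _ hy hg T hT ⟨0, by rintro _ ⟨s, _, rfl⟩; simp⟩
  simp only [hT, le_refl, if_true, hxy, sub_self, norm_zero,
    (h.classKL.classK (T - τ) (sub_nonneg.2 hT)).zero, Real.iSup_const_zero, h.classKInfty.zero,
    add_zero] at he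
  exact sub_eq_zero.1 (norm_le_zero_iff.1 he)

/-- For each r ≥ 0 the δ-ISS estimate is restarted at t - r. The initial difference there is at most
γ(C), by the estimate from t₀. On the window, D s * w r ≤ D s * w (t - s) ≤ v because w decreases,
so the input difference is at most v / w r. If t - r precedes t₀, the estimate from t₀ with equal
initial states is already enough. `exists_classKInfty_fading` removes r. -/
theorem IsDeltaISS.fading_memory (h : IsDeltaISS t₀ f β γ) {w : ℝ → ℝ}
    (hw_anti : AntitoneOn w (Ici 0)) (hw : ∀ r, 0 ≤ r → w r ∈ Ioc (0 : ℝ) 1) {C : ℝ}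
    (hC : 0 ≤ C) :
    ∃ γ', ClassKInfty γ' ∧ ∀ (D : ℝ → ℝ) (u u' : ℝ → U) (x x' : ℝ → X),
      (∀ t, t₀ ≤ t → D t ≤ C) → IsAdmissibleInput t₀ u → IsAdmissibleInput t₀ u' →
      (∀ t, t₀ ≤ t → ‖u' t - u t‖ ≤ D t) →
      IsSolutionOn (fun t ξ => f t ξ (u t)) univ t₀ ⊤ x →
      IsSolutionOn (fun t ξ => f t ξ (u' t)) univ t₀ ⊤ x' → x' t₀ = x t₀ →
      ∀ t, t₀ ≤ t → ‖x' t - x t‖ ≤ γ' (⨆ s : Ico t₀ t, D s * w (t - s)) := by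
  obtain ⟨γ', hγ', hq⟩ := exists_classKInfty_fading h.classKL h.classKInfty hw
    (h.classKInfty.nonneg hC)
  refine ⟨γ', hγ', fun D u u' x x' hDC hu hu' hD hx hx' hxx t ht => ?_⟩
  have hD0 : ∀ s, t₀ ≤ s → 0 ≤ D s := fun s hs => (norm_nonneg _).trans (hD s hs)
  have hbd : BddAbove (range fun s : Ico t₀ t => D s * w (t - s)) := by
    refine ⟨C, ?_⟩
    rintro _ ⟨⟨s, hs⟩, rfl⟩
    have hws := hw (t - s) (sub_nonneg.2 hs.2.le)
    exact (mul_le_of_le_one_right (hD0 s hs.1) hws.2).trans (hDC s hs.1)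
  set v := ⨆ s : Ico t₀ t, D s * w (t - s) with hv
  have hv0 : 0 ≤ v := Real.iSup_nonneg fun s =>
    mul_nonneg (hD0 s s.2.1) (hw _ (sub_nonneg.2 s.2.2.le)).1.le
  have est : ∀ τ t' B, t₀ ≤ τ → τ ≤ t' → 0 ≤ B →
      (∀ s, τ ≤ s → s < t' → ‖u' s - u s‖ ≤ B) →
      ‖x' t' - x t'‖ ≤ β ‖x' τ - x τ‖ (t' - τ) + γ B := by
    intro τ t' B hτ hτt hB hle
    have h1 := h.estimate τ hτ u u' (hu.mono hτ) (hu'.mono hτ) x x' (hx.restrict hτ le_rfl)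
      (hx'.restrict hτ le_rfl) t' hτt ⟨B, by
        rintro _ ⟨s, hs, rfl⟩
        exact hle s hs.1 hs.2⟩
    refine h1.trans (add_le_add_right (h.classKInfty.mono (Real.iSup_nonneg fun _ =>
      norm_nonneg _) (Real.iSup_le (fun s : Ico τ t' => hle s.1 s.2.1 s.2.2) hB)) _)
  have est0 : ∀ t' B, t₀ ≤ t' → 0 ≤ B →
      (∀ s, t₀ ≤ s → s < t' → ‖u' s - u s‖ ≤ B) → ‖x' t' - x t'‖ ≤ γ B := by
    intro t' B ht' hB hle
    have := est t₀ t' B le_rfl ht' hB hle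
    rwa [hxx, sub_self, norm_zero, (h.classKL.classK _ (sub_nonneg.2 ht')).zero, zero_add] at this
  refine hq v hv0 _ fun r hr => ?_
  have hwr := (hw r hr).1
  have hle : ∀ s, t₀ ≤ s → t - r ≤ s → s < t → ‖u' s - u s‖ ≤ v / w r := by
    intro s hs hs' hst
    rw [le_div_iff₀ hwr]
    calc ‖u' s - u s‖ * w r ≤ D s * w (t - s) :=
          mul_le_mul (hD s hs) (hw_anti (mem_Ici.2 (by linarith)) (mem_Ici.2 hr) (by linarith))
            hwr.le (hD0 s hs)
      _ ≤ v := le_ciSup hbd ⟨s, hs, hst⟩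
  have hB : 0 ≤ v / w r := div_nonneg hv0 hwr.le
  rcases le_total t₀ (t - r) with hcase | hcase
  · refine (est (t - r) t _ hcase (by linarith) hB
      fun s hs hst => hle s (hcase.trans hs) hs hst).trans ?_
    rw [sub_sub_cancel]
    refine add_le_add_left ((h.classKL.classK r hr).mono (norm_nonneg _)
      (est0 _ C hcase hC fun s hs _ => (hD s hs).trans (hDC s hs))) _
  · exact (est0 t _ ht hB fun s hs hst => hle s hs (hcase.trans hs) hst).trans
      (le_add_of_nonneg_left (h.classKL.nonneg (h.classKInfty.nonneg hC) hr))

end DeltaISS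

/-! ### Carathéodory's existence theorem -/

/-- Along a simple function the superposition is a finite sum of indicators of measurable maps;
simple approximations of x and continuity in the state give the general case as a pointwise limit.
-/
theorem aestronglyMeasurable_superposition {X Y : Type*} [TopologicalSpace X]
    [TopologicalSpace.PseudoMetrizableSpace X] [NormedAddCommGroup Y] {μ : Measure ℝ}
    {g : ℝ → X → Y} (hcont : ∀ t, Continuous (g t))
    (hmeas : ∀ x, AEStronglyMeasurable (fun t => g t x) μ) {x : ℝ → X} (hx : Continuous x) :
    AEStronglyMeasurable (fun t => g t (x t)) μ := by
  have hsm := hx.stronglyMeasurable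
  refine aestronglyMeasurable_of_tendsto_ae atTop (f := fun n t => g t (hsm.approx n t)) ?_
    (Eventually.of_forall fun t => ((hcont t).tendsto _).comp (hsm.tendsto_approx t))
  intro n
  set φ := hsm.approx n
  have : (fun t => g t (φ t)) =
      fun t => ∑ y ∈ φ.range, (φ ⁻¹' {y}).indicator (fun t => g t y) t := by
    funext t
    rw [Finset.sum_eq_single (φ t)]
    · simp
    · intro y _ hy
      exact indicator_of_notMem (by simpa using hy.symm) _
    · intro h
      exact (h (φ.mem_range_self t)).elim
  rw [this]
  exact Finset.aestronglyMeasurable_fun_sum _ fun y _ =>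
    (hmeas y).indicator (φ.measurableSet_fiber y)

section Existence

variable {X : Type*} [NormedAddCommGroup X] [NormedSpace ℝ X]

theorem lipschitzWith_integral {k : ℝ → X} {C : NNReal} (hk : AEStronglyMeasurable k volume)
    (hC : ∀ t, ‖k t‖ ≤ C) (b : ℝ) : LipschitzWith C (fun t => ∫ s in b..t, k s) := by
  have hint : ∀ p q : ℝ, IntervalIntegrable k volume p q := fun p q =>
    (intervalIntegrable_const (c := (C : ℝ))).mono_fun hk.restrict
      (Eventually.of_forall fun t => by simpa using hC t)
  refine LipschitzWith.of_dist_le_mul fun s t => ?_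
  rw [dist_eq_norm, intervalIntegral.integral_interval_sub_left (hint _ _) (hint _ _),
    Real.dist_eq]
  exact intervalIntegral.norm_integral_le_of_norm_le_const fun r _ => hC r

/-- The radial retraction onto the closed ball `B(ξ, r)`. -/
def radialRetraction (ξ : X) (r : ℝ) (η : X) : X := ξ + (r / max r ‖η - ξ‖) • (η - ξ)

theorem continuous_radialRetraction (ξ : X) {r : ℝ} (hr : 0 < r) :
    Continuous (radialRetraction ξ r) := by
  unfold radialRetraction
  have : ∀ η : X, max r ‖η - ξ‖ ≠ 0 := fun η => (hr.trans_le (le_max_left _ _)).ne'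
  fun_prop (disch := assumption)

theorem radialRetraction_mem (ξ : X) {r : ℝ} (hr : 0 < r) (η : X) :
    radialRetraction ξ r η ∈ Metric.closedBall ξ r := by
  have h0 : 0 < max r ‖η - ξ‖ := hr.trans_le (le_max_left _ _)
  rw [mem_closedBall_iff_norm, radialRetraction, add_sub_cancel_left, norm_smul, Real.norm_eq_abs,
    abs_of_pos (by positivity), div_mul_eq_mul_div, div_le_iff₀ h0]
  exact mul_le_mul_of_nonneg_left (le_max_right _ _) hr.le

theorem radialRetraction_of_mem (ξ : X) {r : ℝ} (hr : 0 < r) {η : X}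
    (h : η ∈ Metric.closedBall ξ r) : radialRetraction ξ r η = η := by
  rw [mem_closedBall_iff_norm] at h
  rw [radialRetraction, max_eq_left h, div_self hr.ne', one_smul, add_sub_cancel]

/-- The integral operator of the delayed equation `x'(t) = g(t, x(t - h))`, `x(b) = ξ`. -/
def delayedPicard (g : ℝ → X → X) (b : ℝ) (ξ : X) (h : ℝ) (x : ℝ → X) (t : ℝ) : X :=
  ξ + ∫ s in b..max t b, g s (x (s - h))

variable {g : ℝ → X → X} {C : NNReal}

theorem lipschitzWith_delayedPicard (hC : ∀ t x, ‖g t x‖ ≤ C) (hcont : ∀ t, Continuous (g t))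
    (hmeas : ∀ x, AEStronglyMeasurable (fun t => g t x) volume) (b : ℝ) (ξ : X) (h : ℝ)
    {x : ℝ → X} (hx : Continuous x) : LipschitzWith C (delayedPicard g b ξ h x) := by
  have h1 := lipschitzWith_integral
    (aestronglyMeasurable_superposition hcont hmeas (hx.comp (continuous_id.sub continuous_const)))
    (fun t => hC t (x (t - h))) b
  refine LipschitzWith.of_dist_le_mul fun s t => ?_
  have h2 := (h1.comp (LipschitzWith.id.max_const b)).dist_le_mul s t
  simpa [delayedPicard, dist_add_left] using h2

/-- Tonelli's approximation. With delay h the integrand at time s sees the function only up to s -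
h, so each Picard iteration fixes the values on a further interval of length h, and the iteration
becomes stationary on [b, b + 1] after k + 1 steps. No contraction is needed. -/
theorem exists_delayed_solution (hC : ∀ t x, ‖g t x‖ ≤ C) (hcont : ∀ t, Continuous (g t))
    (hmeas : ∀ x, AEStronglyMeasurable (fun t => g t x) volume) (b : ℝ) (ξ : X) (k : ℕ) :
    ∃ u : ℝ → X, LipschitzWith C u ∧
      ∀ t ∈ Icc b (b + 1), u t = ξ + ∫ s in b..t, g s (u (s - 1 / ((k : ℝ) + 1))) := by
  set h : ℝ := 1 / ((k : ℝ) + 1) with hh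
  have hpos : 0 < h := by positivity
  set u : ℕ → ℝ → X := fun n => (delayedPicard g b ξ h)^[n] (fun _ => ξ) with hu
  have hsucc : ∀ n, u (n + 1) = delayedPicard g b ξ h (u n) := fun n => by
    simp only [hu, Function.iterate_succ_apply']
  have hLip : ∀ n, LipschitzWith C (u n) := by
    intro n
    induction n with
    | zero => exact (LipschitzWith.const ξ).weaken (zero_le)
    | succ n ih =>
      rw [hsucc]
      exact lipschitzWith_delayedPicard hC hcont hmeas b ξ h ih.continuous
  have hstab : ∀ n : ℕ, ∀ t, t ≤ b + n * h → u (n + 1) t = u n t := by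
    intro n
    induction n with
    | zero =>
      intro t ht
      rw [hsucc]
      simp only [Nat.cast_zero, zero_mul, add_zero] at ht
      simp [delayedPicard, hu, max_eq_right ht]
    | succ n ih =>
      intro t ht
      rw [hsucc, hsucc n]
      simp only [delayedPicard]
      congr 1
      refine intervalIntegral.integral_congr fun s hs => ?_
      rw [uIcc_of_le (le_max_right _ _)] at hs
      have hb : b ≤ b + (n + 1 : ℕ) * h := le_add_of_nonneg_right (by positivity)
      have hs2 := hs.2.trans (max_le ht hb)
      push_cast at hs2
      have := ih (s - h) (by linarith)
      rw [hsucc] at this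
      simp only [delayedPicard] at this ⊢
      rw [this]
  refine ⟨u (k + 1), hLip _, fun t ht => ?_⟩
  have hk : b + 1 = b + (k + 1 : ℕ) * h := by
    rw [hh]; push_cast; field_simp
  rw [← hstab (k + 1) t (hk ▸ ht.2), hsucc, delayedPicard, max_eq_left ht.1]

variable [FiniteDimensional ℝ X]

/-- The delayed solutions are C-Lipschitz and start at ξ, so Arzelà–Ascoli gives a uniformly
convergent subsequence on [b, b + 1]. A delay of 1 / (k + 1) changes values by at most C / (k + 1),
and dominated convergence passes to the limit in the integral equation. -/
theorem exists_integral_solution (hC : ∀ t x, ‖g t x‖ ≤ C) (hcont : ∀ t, Continuous (g t))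
    (hmeas : ∀ x, AEStronglyMeasurable (fun t => g t x) volume) (b : ℝ) (ξ : X) :
    ∃ x : ℝ → X, Continuous x ∧
      ∀ t ∈ Icc b (b + 1), x t = ξ + ∫ s in b..t, g s (x s) := by
  choose u hLip hu using exists_delayed_solution hC hcont hmeas b ξ
  have hb1 : b ≤ b + 1 := by linarith
  have hub : ∀ k, u k b = ξ := fun k => by simpa using hu k b (left_mem_Icc.2 hb1)
  let U : ℕ → BoundedContinuousFunction (Icc b (b + 1)) X := fun k =>
    BoundedContinuousFunction.mkOfCompact ⟨fun t => u k t, (hLip k).continuous.comp continuous_subtype_val⟩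
  have hcompact : IsCompact (closure (range U)) := by
    refine BoundedContinuousFunction.arzela_ascoli (Metric.closedBall ξ C)
      (isCompact_closedBall _ _) _ ?_ ?_
    · rintro _ ⟨t, ht⟩ ⟨k, rfl⟩
      have := (hLip k).dist_le_mul t b
      rw [hub] at this
      refine Metric.mem_closedBall.2 (this.trans ?_)
      refine mul_le_of_le_one_right C.2 ?_
      rw [Real.dist_eq, abs_of_nonneg (by linarith [ht.1])]
      linarith [ht.2]
    · refine LipschitzWith.uniformEquicontinuous _ C ?_ |>.equicontinuous
      rintro ⟨_, k, rfl⟩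
      exact (hLip k).comp (LipschitzWith.subtype_val _) |>.weaken (by simp)
  obtain ⟨v, -, φ, hφ, hv⟩ := hcompact.tendsto_subseq
    (fun k => subset_closure (mem_range_self (f := U) k))
  let x : ℝ → X := IccExtend hb1 v
  have hx : Continuous x := v.continuous.Icc_extend'
  have hlim : ∀ t ∈ Icc b (b + 1), Tendsto (fun k => u (φ k) t) atTop (𝓝 (x t)) := by
    intro t ht
    have h1 := ((BoundedContinuousFunction.lipschitz_eval_const (⟨t, ht⟩ : Icc b (b + 1))).continuous.tendsto
      v).comp hv
    rw [show x t = v ⟨t, ht⟩ from IccExtend_of_mem hb1 _ ht]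
    exact h1
  have hlim' : ∀ t ∈ Icc b (b + 1),
      Tendsto (fun k => u (φ k) (t - 1 / ((φ k : ℝ) + 1))) atTop (𝓝 (x t)) := by
    intro t ht
    refine tendsto_of_tendsto_of_dist (hlim t ht) ?_
    refine squeeze_zero (fun _ => dist_nonneg) (fun k => (hLip (φ k)).dist_le_mul _ _) ?_
    have h0 : Tendsto (fun k => (1 : ℝ) / ((φ k : ℝ) + 1)) atTop (𝓝 0) :=
      tendsto_one_div_add_atTop_nhds_zero_nat.comp hφ.tendsto_atTop
    have h1 : ∀ k, dist t (t - 1 / ((φ k : ℝ) + 1)) = 1 / ((φ k : ℝ) + 1) := fun k => by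
      rw [Real.dist_eq, sub_sub_cancel, abs_of_nonneg (by positivity)]
    simp only [h1]
    simpa using h0.const_mul (C : ℝ)
  refine ⟨x, hx, fun t ht => ?_⟩
  refine tendsto_nhds_unique (hlim t ht) ?_
  simp only [fun k => hu (φ k) t ht]
  refine tendsto_const_nhds.add ?_
  refine intervalIntegral.tendsto_integral_filter_of_dominated_convergence (fun _ => (C : ℝ))
    (Eventually.of_forall fun k => ?_) (Eventually.of_forall fun k => Eventually.of_forall
      fun s _ => hC _ _) intervalIntegrable_const (Eventually.of_forall fun s hs => ?_)
  · exact (aestronglyMeasurable_superposition hcont hmeas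
      ((hLip (φ k)).continuous.comp (continuous_id.sub continuous_const))).restrict
  · rw [uIoc_of_le ht.1] at hs
    exact ((hcont s).tendsto _).comp (hlim' s ⟨hs.1.le, hs.2.trans ht.2⟩)

/-- Composing f with the retraction onto the ball and cutting it off outside the time interval
yields a globally bounded right-hand side that is continuous in the state. Its solution stays in the
ball for a short time, and there the modification is invisible. -/
theorem exists_local_solution {f : ℝ → X → X} {D : Set (ℝ × X)} {b h r C : ℝ} {ξ : X}
    (hh : 0 < h) (hr : 0 < r)
    (hD : ∀ t ∈ Icc b (b + h), ∀ η ∈ Metric.closedBall ξ r, (t, η) ∈ D)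
    (hC : ∀ t ∈ Icc b (b + h), ∀ η ∈ Metric.closedBall ξ r, ‖f t η‖ ≤ C)
    (hcont : ∀ t ∈ Icc b (b + h), ContinuousOn (f t) (Metric.closedBall ξ r))
    (hmeas : ∀ η ∈ Metric.closedBall ξ r,
      AEStronglyMeasurable (fun t => f t η) (volume.restrict (Icc b (b + h)))) :
    ∃ (c : ℝ) (x : ℝ → X), b < c ∧ x b = ξ ∧ IsSolutionOn f D b c x := by
  classical
  have := FiniteDimensional.complete ℝ X
  have hC0 : 0 ≤ C := (norm_nonneg _).trans
    (hC b (left_mem_Icc.2 (by linarith)) ξ (Metric.mem_closedBall_self hr.le))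
  lift C to NNReal using hC0
  let g : ℝ → X → X := fun t η =>
    (Icc b (b + h)).indicator (fun t => f t (radialRetraction ξ r η)) t
  have hgC : ∀ t η, ‖g t η‖ ≤ C := by
    intro t η
    by_cases ht : t ∈ Icc b (b + h)
    · simpa only [g, indicator_of_mem ht] using hC t ht _ (radialRetraction_mem ξ hr η)
    · simp [g, indicator_of_notMem ht]
  have hgcont : ∀ t, Continuous (g t) := by
    intro t
    by_cases ht : t ∈ Icc b (b + h)
    · simp only [g, indicator_of_mem ht]
      exact (hcont t ht).comp_continuous (continuous_radialRetraction ξ hr)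
        (radialRetraction_mem ξ hr)
    · simp only [g, indicator_of_notMem ht]
      exact continuous_const
  have hgmeas : ∀ η, AEStronglyMeasurable (fun t => g t η) volume := fun η =>
    (aestronglyMeasurable_indicator_iff measurableSet_Icc).2 (hmeas _ (radialRetraction_mem ξ hr η))
  obtain ⟨x, hx, hxint⟩ := exists_integral_solution hgC hgcont hgmeas b ξ
  have hxb : x b = ξ := by simpa using hxint b (by simp)
  obtain ⟨ε, hε, hball⟩ := Metric.continuousAt_iff.1 hx.continuousAt r hr
  have hsm := aestronglyMeasurable_superposition hgcont hgmeas hx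
  have hLip := lipschitzWith_integral hsm (fun t => hgC t (x t)) b
  -- The three bounds keep the solution in the ball, the time in the domain of the hypotheses, and
  -- the time in the interval where the integral equation holds.
  have hmin : 0 < min ε (min h 1) := by positivity
  have hmem : ∀ t : ℝ, b ≤ t → t < b + min ε (min h 1) →
      t ∈ Icc b (b + h) ∧ t < b + 1 ∧ x t ∈ Metric.closedBall ξ r := by
    intro t ht hlt
    have e1 := min_le_left ε (min h 1)
    have e2 := (min_le_right ε (min h 1)).trans (min_le_left h 1)
    have e3 := (min_le_right ε (min h 1)).trans (min_le_right h 1)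
    refine ⟨⟨ht, by linarith⟩, by linarith, ?_⟩
    have := hball (x := t) (by rw [Real.dist_eq, abs_of_nonneg] <;> linarith)
    rw [hxb] at this
    exact Metric.mem_closedBall.2 this.le
  refine ⟨b + min ε (min h 1), x, by linarith, hxb, ?_, ?_, ?_⟩
  · intro t ht hlt
    obtain ⟨h1, -, h2⟩ := hmem t ht (EReal.coe_lt_coe_iff.1 hlt)
    exact hD t h1 _ h2
  · intro T hT hlt
    have hL2 : LipschitzWith C (fun t => ξ + ∫ s in b..t, g s (x s)) :=
      LipschitzWith.of_dist_le_mul fun s t => by simpa [dist_add_left] using hLip.dist_le_mul s t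
    refine absolutelyContinuous_congr
      (hL2.lipschitzOnWith (s := uIcc b T)).absolutelyContinuousOnInterval fun t ht => ?_
    rw [uIcc_of_le hT] at ht
    exact hxint t ⟨ht.1, ht.2.trans (hmem T hT (EReal.coe_lt_coe_iff.1 hlt)).2.1.le⟩
  · have hli : LocallyIntegrable (fun s => g s (x s)) volume :=
      (locallyIntegrable_const (C : ℝ)).mono hsm
        (Eventually.of_forall fun t => by simpa using hgC t (x t))
    filter_upwards [LocallyIntegrable.ae_hasDerivAt_integral hli] with t ht hbt hlt
    obtain ⟨h1, h1', h2⟩ := hmem t hbt.le (EReal.coe_lt_coe_iff.1 hlt)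
    have h3 : f t (x t) = g t (x t) := by
      simp only [g, indicator_of_mem h1, radialRetraction_of_mem ξ hr h2]
    rw [h3]
    refine ((ht b).const_add ξ).congr_of_eventuallyEq ?_
    filter_upwards [Ioo_mem_nhds hbt h1'] with s hs
    exact hxint s ⟨hs.1.le, hs.2.le⟩

end Existence

/-! ### Maximal solutions -/

section Maximal

variable {X : Type*} [NormedAddCommGroup X] [NormedSpace ℝ X] {f : ℝ → X → X} {D : Set (ℝ × X)}
  {a : ℝ} {ω : EReal}

theorem IsSolutionOn.congr {x y : ℝ → X} (h : IsSolutionOn f D a ω x)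
    (hxy : ∀ t : ℝ, a ≤ t → (t : EReal) < ω → y t = x t) : IsSolutionOn f D a ω y where
  mem_domain t ht hlt := by
    rw [hxy t ht hlt]
    exact h.mem_domain t ht hlt
  absolutelyContinuous T hT hlt := by
    refine absolutelyContinuous_congr (h.absolutelyContinuous T hT hlt) fun t ht => ?_
    rw [uIcc_of_le hT] at ht
    exact hxy t ht.1 ((EReal.coe_le_coe_iff.2 ht.2).trans_lt hlt)
  hasDerivAt := by
    filter_upwards [h.hasDerivAt] with t ht h1 h2
    rw [hxy t h1.le h2]
    obtain ⟨q, hq1, hq2⟩ := EReal.lt_iff_exists_real_btwn.1 h2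
    refine (ht h1 h2).congr_of_eventuallyEq ?_
    filter_upwards [Ioo_mem_nhds h1 (EReal.coe_lt_coe_iff.1 hq1)] with s hs
    exact hxy s hs.1.le ((EReal.coe_lt_coe_iff.2 hs.2).trans hq2)

/-- The exceptional null set may depend on T; only rational T are used for the differential
equation, so that countably many null sets are united. -/
theorem isSolutionOn_of_forall_lt {x : ℝ → X}
    (h : ∀ T : ℝ, a ≤ T → (T : EReal) < ω → ∃ ω' : EReal, (T : EReal) < ω' ∧
      IsSolutionOn f D a ω' x) : IsSolutionOn f D a ω x where
  mem_domain t ht hlt := by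
    obtain ⟨ω', h1, h2⟩ := h t ht hlt
    exact h2.mem_domain t ht h1
  absolutelyContinuous T hT hlt := by
    obtain ⟨ω', h1, h2⟩ := h T hT hlt
    exact h2.absolutelyContinuous T hT h1
  hasDerivAt := by
    have hq : ∀ q : ℚ, ∀ᵐ t : ℝ, a < t → t < (q : ℝ) → ((q : ℝ) : EReal) < ω →
        HasDerivAt x (f t (x t)) t := by
      intro q
      by_cases hq : a ≤ q ∧ ((q : ℝ) : EReal) < ω
      · obtain ⟨ω', h1, h2⟩ := h q hq.1 hq.2
        filter_upwards [h2.hasDerivAt] with t ht hat htq _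
        exact ht hat ((EReal.coe_lt_coe_iff.2 htq).trans h1)
      · refine Eventually.of_forall fun t hat htq hqω => (hq ⟨(hat.trans htq).le, hqω⟩).elim
    filter_upwards [ae_all_iff.2 hq] with t ht hat hlt
    obtain ⟨q, hq1, hq2⟩ := EReal.lt_iff_exists_rat_btwn.1 hlt
    exact ht q hat (EReal.coe_lt_coe_iff.1 hq1) hq2

/-- Zorn's lemma for extension of solutions; a nonempty chain is bounded by the union of its members
on the supremum of their lifetimes. -/
theorem exists_isMaximalSolution {x₀ : ℝ → X} {ω₀ : EReal} (hlt : (a : EReal) < ω₀)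
    (h₀ : IsSolutionOn f D a ω₀ x₀) :
    ∃ (ω : EReal) (x : ℝ → X), x a = x₀ a ∧ IsMaximalSolution f D a ω x := by
  classical
  let P := {p : EReal × (ℝ → X) // (a : EReal) < p.1 ∧ p.2 a = x₀ a ∧ IsSolutionOn f D a p.1 p.2}
  -- Only a preorder, since values beyond the lifetime are arbitrary; comparing lifetimes is all
  -- that maximality requires.
  let r : P → P → Prop := fun p q => p.1.1 ≤ q.1.1 ∧
    ∀ t : ℝ, a ≤ t → (t : EReal) < p.1.1 → q.1.2 t = p.1.2 t
  have hmax : ∃ m : P, ∀ p, r m p → r p m := by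
    refine exists_maximal_of_chains_bounded (r := r) (fun c hc => ?_) ?_
    · rcases c.eq_empty_or_nonempty with rfl | ⟨p₀, hp₀⟩
      · exact ⟨⟨(ω₀, x₀), hlt, rfl, h₀⟩, fun p hp => hp.elim⟩
      let x : ℝ → X := fun t =>
        if h : ∃ p ∈ c, (t : EReal) < p.1.1 then h.choose.1.2 t else 0
      have hx : ∀ p ∈ c, ∀ t : ℝ, a ≤ t → (t : EReal) < p.1.1 → x t = p.1.2 t := by
        intro p hp t hat htp
        have hex : ∃ p ∈ c, (t : EReal) < p.1.1 := ⟨p, hp, htp⟩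
        have hxt : x t = hex.choose.1.2 t := dif_pos hex
        rw [hxt]
        obtain ⟨hq, htq⟩ := hex.choose_spec
        by_cases hpq : hex.choose = p
        · rw [hpq]
        rcases hc hq hp hpq with h | h
        · exact (h.2 t hat htq).symm
        · exact h.2 t hat htp
      have hle : ∀ p ∈ c, p.1.1 ≤ sSup ((fun p : P => p.1.1) '' c) := fun p hp =>
        le_sSup ⟨p, hp, rfl⟩
      refine ⟨⟨(sSup ((fun p : P => p.1.1) '' c), x), p₀.2.1.trans_le (hle p₀ hp₀), ?_, ?_⟩, ?_⟩
      · exact (hx p₀ hp₀ a le_rfl p₀.2.1).trans p₀.2.2.1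
      · refine isSolutionOn_of_forall_lt fun T hT hTω => ?_
        obtain ⟨_, ⟨p, hp, rfl⟩, hTp⟩ := lt_sSup_iff.1 hTω
        exact ⟨p.1.1, hTp, p.2.2.2.congr fun t h1 h2 => hx p hp t h1 h2⟩
      · intro p hp
        exact ⟨hle p hp, hx p hp⟩
    · intro p q s hpq hqs
      exact ⟨hpq.1.trans hqs.1, fun t hat ht =>
        (hqs.2 t hat (ht.trans_le hpq.1)).trans (hpq.2 t hat ht)⟩
  obtain ⟨m, hm⟩ := hmax
  refine ⟨m.1.1, m.1.2, m.2.2.1, m.2.1, m.2.2.2, fun ω' x' hx' heq => ?_⟩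
  by_contra hcon
  have hlt' := not_le.1 hcon
  refine hcon (hm ⟨(ω', x'), m.2.1.trans hlt', ?_, hx'⟩ ⟨hlt'.le, heq⟩).1
  exact (heq a le_rfl m.2.1).trans m.2.2.1

end Maximal

/-! ### Node potentials separating the end points of critical edges -/

/-- Take v to be the point of least norm in the convex hull of the vectors e₁ - e₂ over the edges of
C. Being in the hull, it is a nonnegative combination of edge differences. The inner product with φ
is positive on the hull, so v ≠ 0, and the variational inequality of the projection gives ⟨v, e₁ -
e₂⟩ ≥ ‖v‖² > 0 for every edge. -/
theorem exists_separating_potential {V : Type*} [Fintype V] [DecidableEq V] (C : Finset (V × V))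
    (φ : V → ℝ) (hφ : ∀ e ∈ C, φ e.2 < φ e.1) :
    ∃ (a : V × V → ℝ) (v : V → ℝ), (∀ e, 0 ≤ a e) ∧
      (∀ y : V → ℝ, ∑ k, v k * y k = ∑ e ∈ C, a e * (y e.1 - y e.2)) ∧
      ∀ e ∈ C, v e.2 < v e.1 := by
  rcases C.eq_empty_or_nonempty with rfl | hne
  · exact ⟨0, 0, by simp, by simp, by simp⟩
  let B : V × V → EuclideanSpace ℝ V := fun e =>
    EuclideanSpace.single e.1 (1 : ℝ) - EuclideanSpace.single e.2 (1 : ℝ)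
  have hinner : ∀ (w : EuclideanSpace ℝ V) e, inner ℝ w (B e) = w e.1 - w e.2 := by
    intro w e
    simp [B, inner_sub_right, EuclideanSpace.inner_single_right]
  let K : Set (EuclideanSpace ℝ V) := convexHull ℝ (B '' C)
  have hfin : (B '' (C : Set (V × V))).Finite := C.finite_toSet.image _
  have hKne : K.Nonempty := (hne.to_set.image B).convexHull
  have hKconv : Convex ℝ K := convex_convexHull ℝ _
  obtain ⟨v, hvK, hv⟩ := exists_norm_eq_iInf_of_complete_convex hKne
    (hfin.isCompact_convexHull ℝ).isComplete hKconv 0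
  have hmin := (norm_eq_iInf_iff_real_inner_le_zero hKconv hvK).1 hv
  have hrep : K ⊆ {w | ∃ a : V × V → ℝ, (∀ e, 0 ≤ a e) ∧
      ∀ y : V → ℝ, ∑ k, w k * y k = ∑ e ∈ C, a e * (y e.1 - y e.2)} := by
    refine convexHull_min ?_ ?_
    · rintro _ ⟨e, he, rfl⟩
      refine ⟨Pi.single e 1, fun e' => ?_, fun y => ?_⟩
      · by_cases h : e' = e
        · subst h; simp
        · simp [h]
      · rw [Finset.sum_eq_single e (fun e' _ h => by simp [h]) (fun h => (h he).elim)]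
        simp [B, sub_mul, Finset.sum_sub_distrib]
    · rintro w ⟨a, ha, hw⟩ w' ⟨a', ha', hw'⟩ p q hp hq _
      refine ⟨fun e => p * a e + q * a' e, fun e => by
        have := ha e; have := ha' e; positivity, fun y => ?_⟩
      simp only [add_mul, mul_assoc, Finset.sum_add_distrib, ← Finset.mul_sum, ← hw y, ← hw' y,
        PiLp.add_apply, PiLp.smul_apply, smul_eq_mul]
  have hpos : K ⊆ {w | 0 < inner ℝ (WithLp.toLp 2 φ : EuclideanSpace ℝ V) w} := by
    refine convexHull_min ?_ ?_
    · rintro _ ⟨e, he, rfl⟩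
      simp only [mem_ofPred_eq, hinner]
      exact sub_pos.2 (hφ e he)
    · intro w hw w' hw' p q hp hq hpq
      simp only [mem_ofPred_eq, inner_add_right, inner_smul_right] at *
      rcases hp.eq_or_lt with rfl | hp
      · have : q = 1 := by linarith
        subst this; simpa using hw'
      · have := mul_pos hp hw
        have := mul_nonneg hq hw'.le
        linarith
  have hv0 : v ≠ 0 := by
    rintro rfl
    have := hpos hvK
    simp at this
  obtain ⟨a, ha, hav⟩ := hrep hvK
  refine ⟨a, v, ha, hav, fun e he => ?_⟩
  have h1 := hmin (B e) (subset_convexHull ℝ _ ⟨e, he, rfl⟩)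
  rw [zero_sub, inner_neg_left, inner_sub_right, hinner, real_inner_self_eq_norm_sq] at h1
  have h2 : 0 < ‖v‖ ^ 2 := by positivity
  linarith

/-- Summation by parts on the graph; the factor 1/2 appears because each pair is counted in both
orders. -/
theorem sum_mul_sum_antisymm {V : Type*} [Fintype V] {g : V → V → ℝ}
    (hg : ∀ i j, g i j = -g j i) (v : V → ℝ) :
    ∑ i, v i * ∑ j, g i j = -(1 / 2) * ∑ i, ∑ j, (v j - v i) * g i j := by
  have h1 : ∑ i, ∑ j, v j * g i j = -∑ i, ∑ j, v i * g i j := by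
    rw [Finset.sum_comm, ← Finset.sum_neg_distrib]
    refine Finset.sum_congr rfl fun i _ => ?_
    rw [← Finset.sum_neg_distrib]
    refine Finset.sum_congr rfl fun j _ => ?_
    rw [hg j i]
    ring
  simp only [sub_mul, Finset.sum_sub_distrib, h1, Finset.mul_sum]
  ring

/-! ### Scalar networks with antisymmetric coupling -/

/-- H and H + f are both monotone and bounded above, so both converge at b, and f is their
difference. -/
theorem exists_tendsto_of_abs_sub_le {f H : ℝ → ℝ} {a b B : ℝ} (hab : a < b)
    (h : ∀ s t, a ≤ s → s ≤ t → t < b → |f t - f s| ≤ H t - H s)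
    (hB : ∀ t, a ≤ t → t < b → H t ≤ B) :
    ∃ l, Tendsto f (𝓝[<] b) (𝓝 l) := by
  have hmono : ∀ k : ℝ, |k| ≤ 1 → MonotoneOn (fun t => H t + k * f t) (Ioo a b) := by
    intro k hk s hs t ht hst
    have h1 := h s t hs.1.le hst ht.2
    have h2 : |k * (f t - f s)| ≤ 1 * |f t - f s| := by
      rw [abs_mul]; exact mul_le_mul_of_nonneg_right hk (abs_nonneg _)
    have h3 := neg_abs_le (k * (f t - f s))
    simp only
    linarith
  have hbdd : ∀ k : ℝ, |k| ≤ 1 → BddAbove ((fun t => H t + k * f t) '' Ioo a b) := by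
    intro k hk
    refine ⟨B + (|f a| + (B - H a)), ?_⟩
    rintro _ ⟨t, ht, rfl⟩
    have h1 := h a t le_rfl ht.1.le ht.2
    have h2 := hB t ht.1.le ht.2
    have h3 : |k * f t| ≤ 1 * |f t| := by
      rw [abs_mul]; exact mul_le_mul_of_nonneg_right hk (abs_nonneg _)
    have h4 := le_abs_self (k * f t)
    have h5 : |f t| ≤ |f t - f a| + |f a| := by simpa using abs_add_le (f t - f a) (f a)
    simp only
    linarith
  have hne : (Ioo a b).Nonempty := nonempty_Ioo.2 hab
  have l1 := MonotoneOn.tendsto_nhdsWithin_Ioo_left hne (hmono 1 (by simp)) (hbdd 1 (by simp))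
  have l0 := MonotoneOn.tendsto_nhdsWithin_Ioo_left hne (hmono 0 (by simp)) (hbdd 0 (by simp))
  exact ⟨_, (l1.sub l0).congr fun t => by ring⟩

section ScalarNetwork

variable {V : Type*} [Fintype V] {a b : ℝ} {y F : V → ℝ → ℝ} {g : V → V → ℝ → ℝ} {M : ℝ}

/-- Node trajectories with a bounded drift and a dissipative antisymmetric coupling converge in
finite time. -/
theorem exists_tendsto_of_dissipative {B C κ : ℝ} (hab : a < b)
    (hy : ∀ i T, a ≤ T → T < b → AbsolutelyContinuousOnInterval (y i) a T)
    (hB : ∀ i t, a ≤ t → t < b → |y i t| ≤ B)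
    (hF : ∀ i t, a ≤ t → t < b → |F i t| ≤ M)
    (hy' : ∀ i, ∀ᵐ t, a < t → t < b → HasDerivAt (y i) (F i t + ∑ j, g i j t) t)
    (hg : ∀ i j t, a ≤ t → t < b → g i j t = -g j i t) (hκ : 0 < κ)
    (hdiss : ∀ i j t, a ≤ t → t < b → κ * |g i j t| ≤ (y j t - y i t) * g i j t + C) :
    ∃ ys : V → ℝ, ∀ i, Tendsto (y i) (𝓝[<] b) (𝓝 (ys i)) := by
  set n : ℝ := (Fintype.card V : ℝ) with hn
  -- Dissipativity gives E' ≤ A - (κ/2) ∑ |g|: the first term of A bounds the work of the drift, the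
  -- second collects the constant C over ordered pairs. Solving for ∑ |g| bounds every |yᵢ'| by M +
  -- (2/κ)(A - E'), which is the derivative of H below.
  set A : ℝ := n * (B * M) + 1 / 2 * (n * (n * C)) with hA
  let E : ℝ → ℝ := fun t => ∑ i, 1 / 2 * (y i t * y i t)
  let E' : ℝ → ℝ := fun t => ∑ i, y i t * (F i t + ∑ j, g i j t)
  let H : ℝ → ℝ := fun t => (M + 2 / κ * A) * t - 2 / κ * E t
  have hE : ∀ T, a ≤ T → T < b → AbsolutelyContinuousOnInterval E a T := fun T h1 h2 =>
    absolutelyContinuous_finset_sum _ fun i _ => ((hy i T h1 h2).mul (hy i T h1 h2)).const_mul _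
  have hE' : ∀ᵐ t, a < t → t < b → HasDerivAt E (E' t) t := by
    filter_upwards [ae_all_iff.2 hy'] with t ht h1 h2
    have := HasDerivAt.fun_sum (u := Finset.univ) fun i _ =>
      ((ht i h1 h2).mul (ht i h1 h2)).const_mul (1 / 2 : ℝ)
    refine this.congr_deriv (Finset.sum_congr rfl fun i _ => by ring)
  have hHac : ∀ T, a ≤ T → T < b → AbsolutelyContinuousOnInterval H a T := fun T h1 h2 =>
    ((LipschitzWith.id.lipschitzOnWith (s := uIcc a T)).absolutelyContinuousOnInterval.const_mul
      (M + 2 / κ * A)).sub ((hE T h1 h2).const_mul (2 / κ))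
  have hH' : ∀ᵐ t, a < t → t < b → HasDerivAt H ((M + 2 / κ * A) - 2 / κ * E' t) t := by
    filter_upwards [hE'] with t ht h1 h2
    have := ((hasDerivAt_id t).const_mul (M + 2 / κ * A)).sub ((ht h1 h2).const_mul (2 / κ))
    rwa [mul_one] at this
  have hbound : ∀ i t, a ≤ t → t < b →
      |F i t + ∑ j, g i j t| ≤ (M + 2 / κ * A) - 2 / κ * E' t := by
    intro i t h1 h2
    have e1 : E' t ≤ A - κ / 2 * ∑ i, ∑ j, |g i j t| := by
      have hsplit : E' t = ∑ i, y i t * F i t + ∑ i, y i t * ∑ j, g i j t := by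
        simp only [E', mul_add, Finset.sum_add_distrib]
      rw [hsplit, sum_mul_sum_antisymm (fun i j => hg i j t h1 h2)]
      have s1 : ∑ i, y i t * F i t ≤ n * (B * M) := by
        refine (Finset.sum_le_card_nsmul _ _ (B * M) fun i _ => ?_).trans (by simp [hn])
        refine (le_abs_self _).trans ?_
        rw [abs_mul]
        exact mul_le_mul (hB i t h1 h2) (hF i t h1 h2) (abs_nonneg _)
          ((abs_nonneg _).trans (hB i t h1 h2))
      have s2 : κ * ∑ i, ∑ j, |g i j t| ≤
          ∑ i, ∑ j, (y j t - y i t) * g i j t + n * (n * C) := by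
        have : n * (n * C) = ∑ _i : V, ∑ _j : V, C := by simp [hn]
        rw [this, ← Finset.sum_add_distrib, Finset.mul_sum]
        refine Finset.sum_le_sum fun i _ => ?_
        rw [← Finset.sum_add_distrib, Finset.mul_sum]
        exact Finset.sum_le_sum fun j _ => hdiss i j t h1 h2
      rw [hA]
      linarith
    have e2 : |∑ j, g i j t| ≤ ∑ i, ∑ j, |g i j t| :=
      (Finset.abs_sum_le_sum_abs _ _).trans (Finset.single_le_sum
        (f := fun i => ∑ j, |g i j t|) (fun i _ => Finset.sum_nonneg fun j _ => abs_nonneg _)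
        (Finset.mem_univ i))
    have e3 : ∑ i, ∑ j, |g i j t| ≤ 2 / κ * (A - E' t) := by
      rw [div_mul_eq_mul_div, le_div_iff₀ hκ]
      linarith
    have e4 := abs_add_le (F i t) (∑ j, g i j t)
    have e5 := hF i t h1 h2
    linarith
  have hsub : ∀ {s t : ℝ}, a ≤ s → s ≤ t → t < b → ∀ {f : ℝ → ℝ},
      AbsolutelyContinuousOnInterval f a t → AbsolutelyContinuousOnInterval f s t := by
    intro s t h1 h2 _ f hf
    exact hf.mono (by rw [uIcc_of_le h2, uIcc_of_le (h1.trans h2)]; exact Icc_subset_Icc_left h1)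
  have key : ∀ i s t, a ≤ s → s ≤ t → t < b → |y i t - y i s| ≤ H t - H s := by
    intro i s t h1 h2 h3
    have hHs := hsub h1 h2 h3 (hHac t (h1.trans h2) h3)
    have hys := hsub h1 h2 h3 (hy i t (h1.trans h2) h3)
    have d1 : ∀ᵐ r, r ∈ Ioo s t → HasDerivAt (y i) (F i r + ∑ j, g i j r) r := by
      filter_upwards [hy' i] with r hr hrs
      exact hr (h1.trans_lt hrs.1) (hrs.2.trans h3)
    have d2 : ∀ᵐ r, r ∈ Ioo s t → HasDerivAt H ((M + 2 / κ * A) - 2 / κ * E' r) r := by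
      filter_upwards [hH'] with r hr hrs
      exact hr (h1.trans_lt hrs.1) (hrs.2.trans h3)
    rw [abs_le']
    constructor
    · exact sub_le_of_ae_hasDerivAt_le h2 hys hHs d1 d2 (Eventually.of_forall fun r hr =>
        (le_abs_self _).trans (hbound i r (h1.trans hr.1.le) (hr.2.trans h3)))
    · have := sub_le_of_ae_hasDerivAt_le h2 hys.neg hHs
        (f' := fun r => -(F i r + ∑ j, g i j r))
        (by filter_upwards [d1] with r hr hrs using (hr hrs).neg) d2
        (Eventually.of_forall fun r hr =>
        (neg_le_abs _).trans (hbound i r (h1.trans hr.1.le) (hr.2.trans h3)))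
      simp only [Pi.neg_apply] at this
      linarith
  -- H is bounded above because the energy E is nonnegative and enters with a minus sign.
  have hHB : ∀ t, a ≤ t → t < b → H t ≤ |M + 2 / κ * A| * (|a| + |b|) := by
    intro t h1 h2
    have e1 : 0 ≤ E t := Finset.sum_nonneg fun i _ => by nlinarith [mul_self_nonneg (y i t)]
    have e2 : 0 ≤ 2 / κ * E t := by positivity
    have e3 : |t| ≤ |a| + |b| := by
      rw [abs_le]
      constructor
      · linarith [neg_abs_le a, abs_nonneg b]
      · linarith [le_abs_self b, abs_nonneg a]
    calc H t ≤ (M + 2 / κ * A) * t := by simp only [H]; linarith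
      _ ≤ |M + 2 / κ * A| * |t| := by rw [← abs_mul]; exact le_abs_self _
      _ ≤ _ := mul_le_mul_of_nonneg_left e3 (abs_nonneg _)
  choose ys hys using fun i => exists_tendsto_of_abs_sub_le hab (key i) hHB
  exact ⟨ys, hys⟩

/-- If the coupling along the edges of a nonempty set `K`, on which the limits of the node
trajectories are separated, blows up at time `b` in the attractive direction, then the differences
along `K` cannot all attain barriers at time `b` which they have not crossed before. -/
theorem not_all_barriers_attained {K : Finset (V × V)} (hK : K.Nonempty)
    {ψ ψ' : V × V → ℝ → ℝ} {L : ℝ} {ys : V → ℝ} (hab : a < b)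
    (hy : ∀ i T, a ≤ T → T < b → AbsolutelyContinuousOnInterval (y i) a T)
    (hF : ∀ i t, a ≤ t → t < b → |F i t| ≤ M)
    (hy' : ∀ i, ∀ᵐ t, a < t → t < b → HasDerivAt (y i) (F i t + ∑ j, g i j t) t)
    (hg : ∀ i j t, a ≤ t → t < b → g i j t = -g j i t)
    (hlim : ∀ i, Tendsto (y i) (𝓝[<] b) (𝓝 (ys i)))
    (hψ : ∀ e ∈ K, ∀ T, a ≤ T → T < b → AbsolutelyContinuousOnInterval (ψ e) a T)
    (hψ' : ∀ e ∈ K, ∀ t, a < t → t < b → HasDerivAt (ψ e) (ψ' e t) t)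
    (hψL : ∀ e ∈ K, ∀ t, a < t → t < b → |ψ' e t| ≤ L)
    (hbar : ∀ e ∈ K, ∀ t, a ≤ t → t < b → y e.1 t - y e.2 t ≤ ψ e t)
    (hsep : ∀ e ∈ K, ys e.2 < ys e.1)
    (hatt : ∀ e ∈ K, Tendsto (ψ e) (𝓝[<] b) (𝓝 (ys e.1 - ys e.2)))
    (hblow : ∀ e ∈ K, Tendsto (g e.1 e.2) (𝓝[<] b) atBot)
    (hrest : ∀ i j, (i, j) ∉ K → (j, i) ∉ K → ∃ R, ∀ᶠ t in 𝓝[<] b, |g i j t| ≤ R) : False := by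
  classical
  obtain ⟨α, v, hα, hv, hvK⟩ := exists_separating_potential K ys hsep
  have hnhds : ∀ᶠ t in 𝓝[<] b, a < t ∧ t < b := Ioo_mem_nhdsLT hab
  let T : V × V → ℝ → ℝ := fun p t => (v p.2 - v p.1) * g p.1 p.2 t
  have hTK : ∀ e ∈ K, Tendsto (T e) (𝓝[<] b) atTop := fun e he =>
    (hblow e he).const_mul_atBot_of_neg (sub_neg.2 (hvK e he))
  have hT : ∀ p, ∃ R, ∀ᶠ t in 𝓝[<] b, -R ≤ T p t := by
    intro p
    by_cases h1 : p ∈ K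
    · exact ⟨0, by simpa using (hTK p h1).eventually_ge_atTop 0⟩
    by_cases h2 : (p.2, p.1) ∈ K
    · refine ⟨0, ?_⟩
      filter_upwards [(hTK _ h2).eventually_ge_atTop 0, hnhds] with t ht hat
      simp only [T] at ht ⊢
      rw [hg p.2 p.1 t hat.1.le hat.2] at ht
      linarith
    · obtain ⟨R, hR⟩ := hrest p.1 p.2 h1 h2
      refine ⟨|v p.2 - v p.1| * R, ?_⟩
      filter_upwards [hR] with t ht
      have := neg_abs_le (T p t)
      rw [show |T p t| = |v p.2 - v p.1| * |g p.1 p.2 t| from abs_mul _ _] at this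
      have := mul_le_mul_of_nonneg_left ht (abs_nonneg (v p.2 - v p.1))
      linarith
  choose R hR using hT
  obtain ⟨e₀, he₀⟩ := hK
  -- Every summand is eventually bounded below, so a single diverging one carries the whole sum to
  -- infinity.
  have hsum : Tendsto (fun t => ∑ p, T p t) (𝓝[<] b) atTop := by
    refine tendsto_atTop_mono' _ ?_
      (tendsto_atTop_add_const_right _ (R e₀ - ∑ p, R p) (hTK e₀ he₀))
    filter_upwards [eventually_all.2 hR] with t ht
    have := Finset.single_le_sum (f := fun p => T p t + R p)
      (fun p _ => by have := ht p; linarith) (Finset.mem_univ e₀)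
    rw [Finset.sum_add_distrib] at this
    linarith
  set c : ℝ := ∑ k, |v k| * M + ∑ e ∈ K, α e * L with hc
  -- The constant c bounds the contributions of drift and barriers to W'. The factor 2 compensates
  -- the 1/2 from summation by parts, which leaves W' ≤ -1.
  obtain ⟨t₁, ht₁, hgrow⟩ := (mem_nhdsLT_iff_exists_Ioo_subset' hab).1
    ((hsum.eventually_ge_atTop (2 * (1 + c))).and hnhds)
  let W : ℝ → ℝ := fun t => ∑ k, v k * y k t - ∑ e ∈ K, α e * ψ e t
  let W' : ℝ → ℝ := fun t => ∑ k, v k * (F k t + ∑ j, g k j t) - ∑ e ∈ K, α e * ψ' e t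
  -- The node form of W is suited to differentiation; the edge form shows W ≤ 0 and W → 0 at b.
  have hWeq : ∀ t, W t = ∑ e ∈ K, α e * (y e.1 t - y e.2 t - ψ e t) := by
    intro t
    simp only [W, hv (fun k => y k t), ← Finset.sum_sub_distrib, ← mul_sub]
  have hWle : ∀ t, a ≤ t → t < b → W t ≤ 0 := by
    intro t h1 h2
    rw [hWeq]
    exact Finset.sum_nonpos fun e he =>
      mul_nonpos_of_nonneg_of_nonpos (hα e) (sub_nonpos.2 (hbar e he t h1 h2))
  have hWlim : Tendsto W (𝓝[<] b) (𝓝 0) := by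
    have : Tendsto (fun t => ∑ e ∈ K, α e * (y e.1 t - y e.2 t - ψ e t)) (𝓝[<] b)
        (𝓝 (∑ e ∈ K, α e * (ys e.1 - ys e.2 - (ys e.1 - ys e.2)))) :=
      tendsto_finsetSum _ fun e he => (((hlim e.1).sub (hlim e.2)).sub (hatt e he)).const_mul _
    simpa [hWeq] using this.congr fun t => (hWeq t).symm
  have hWac : ∀ T, a ≤ T → T < b → AbsolutelyContinuousOnInterval W a T := fun T h1 h2 =>
    (absolutelyContinuous_finset_sum _ fun k _ => (hy k T h1 h2).const_mul (v k)).sub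
      (absolutelyContinuous_finset_sum _ fun e he => (hψ e he T h1 h2).const_mul (α e))
  have hW' : ∀ᵐ t, a < t → t < b → HasDerivAt W (W' t) t := by
    filter_upwards [ae_all_iff.2 hy'] with t ht h1 h2
    exact (HasDerivAt.fun_sum fun k _ => (ht k h1 h2).const_mul (v k)).sub
      (HasDerivAt.fun_sum fun e he => (hψ' e he t h1 h2).const_mul (α e))
  have hslope : ∀ t, t ∈ Ioo t₁ b → W' t ≤ -1 := by
    intro t ht
    obtain ⟨e1, e2, e3⟩ := hgrow ht
    have s1 : ∑ k, v k * F k t ≤ ∑ k, |v k| * M := Finset.sum_le_sum fun k _ => by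
      refine (le_abs_self _).trans ?_
      rw [abs_mul]
      exact mul_le_mul_of_nonneg_left (hF k t e2.le e3) (abs_nonneg _)
    have s2 : -∑ e ∈ K, α e * ψ' e t ≤ ∑ e ∈ K, α e * L := by
      rw [← Finset.sum_neg_distrib]
      refine Finset.sum_le_sum fun e he => ?_
      rw [← mul_neg]
      exact mul_le_mul_of_nonneg_left ((neg_le_abs _).trans (hψL e he t e2 e3)) (hα e)
    have s3 : ∑ k, v k * ∑ j, g k j t = -(1 / 2) * ∑ p, T p t := by
      rw [sum_mul_sum_antisymm (fun i j => hg i j t e2.le e3), Fintype.sum_prod_type]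
    have s4 : W' t = ∑ k, v k * F k t + ∑ k, v k * ∑ j, g k j t - ∑ e ∈ K, α e * ψ' e t := by
      simp only [W', mul_add, Finset.sum_add_distrib]
    rw [s4, s3]
    linarith
  obtain ⟨s, hs⟩ := nonempty_Ioo.2 (max_lt ht₁ hab)
  have hs1 : t₁ < s := (le_max_left _ _).trans_lt hs.1
  have hsa : a < s := (le_max_right _ _).trans_lt hs.1
  have hdec : ∀ᶠ t in 𝓝[<] b, W t ≤ W s - (t - s) := by
    filter_upwards [Ioo_mem_nhdsLT hs.2] with t ht
    have hst : s ≤ t := ht.1.le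
    have h1 := sub_le_of_ae_hasDerivAt_le (f := W) (g := fun t => (-1 : ℝ) * t) (f' := W')
      (g' := fun _ => -1) hst
      ((hWac t (hsa.le.trans hst) ht.2).mono (by
        rw [uIcc_of_le hst, uIcc_of_le (hsa.le.trans hst)]
        exact Icc_subset_Icc_left hsa.le))
      ((LipschitzWith.id.lipschitzOnWith (s := uIcc s t)).absolutelyContinuousOnInterval.const_mul
        (-1))
      (by
        filter_upwards [hW'] with r hr hrs
        exact hr (hsa.trans hrs.1) (hrs.2.trans ht.2))
      (Eventually.of_forall fun r _ => by simpa using (hasDerivAt_id r).const_mul (-1 : ℝ))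
      (Eventually.of_forall fun r hr => hslope r ⟨hs1.trans hr.1, hr.2.trans ht.2⟩)
    linarith
  have hid : Tendsto (fun t : ℝ => W s - (t - s)) (𝓝[<] b) (𝓝 (W s - (b - s))) :=
    ((continuous_const.sub (continuous_id.sub continuous_const)).tendsto b).mono_left
      nhdsWithin_le_nhds
  -- In the limit 0 ≤ W s - (b - s), so W s > 0, against W ≤ 0.
  have h1 := le_of_tendsto_of_tendsto hWlim hid hdec
  have h2 := hWle s hsa.le hs.2
  linarith [hs.2]

end ScalarNetwork

/-! ### Funnel coupling of scalar nodes -/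

/-- Near ±1 the coupling has the sign of r and |r| > 1/2, so r μ(r) ≥ |μ(r)| / 2. On the compact
interval in between μ is bounded, and the constant absorbs the rest. -/
theorem exists_dissipativity_bound {μ : ℝ → ℝ} (hc : ContinuousOn μ (Ioo (-1) 1))
    (htop : Tendsto μ (𝓝[<] 1) atTop) (hbot : Tendsto μ (𝓝[>] (-1)) atBot) :
    ∃ C, 0 ≤ C ∧ ∀ r ∈ Ioo (-1 : ℝ) 1, 1 / 2 * |μ r| ≤ r * μ r + C := by
  obtain ⟨p, hp, hp'⟩ := (mem_nhdsLT_iff_exists_Ioo_subset' (a := (1 : ℝ)) (l' := 1 / 2)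
    (by norm_num)).1 ((htop.eventually_ge_atTop 0).and (Ioo_mem_nhdsLT (a := 1 / 2) (by norm_num)))
  obtain ⟨q, hq, hq'⟩ := (mem_nhdsGT_iff_exists_Ioo_subset' (a := (-1 : ℝ)) (u' := -(1 / 2))
    (by norm_num)).1 ((hbot.eventually_le_atBot 0).and
      (Ioo_mem_nhdsGT (show (-1 : ℝ) < -(1 / 2) by norm_num)))
  obtain ⟨C, hC⟩ := (isCompact_Icc (a := q) (b := p)).exists_bound_of_continuousOn
    (hc.mono fun r hr => ⟨(mem_Ioi.1 hq).trans_le hr.1, hr.2.trans_lt (mem_Iio.1 hp)⟩)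
  refine ⟨2 * |C|, by positivity, fun r hr => ?_⟩
  rcases lt_or_ge p r with h1 | h1
  · obtain ⟨e1, e2⟩ := hp' ⟨h1, hr.2⟩
    rw [abs_of_nonneg e1]
    nlinarith [e2.1, abs_nonneg C]
  rcases lt_or_ge r q with h2 | h2
  · obtain ⟨e1, e2⟩ := hq' ⟨hr.1, h2⟩
    rw [abs_of_nonpos e1]
    nlinarith [e2.2, abs_nonneg C]
  · have e1 : |μ r| ≤ |C| := (hC r ⟨h2, h1⟩).trans (le_abs_self C)
    have e2 : |r * μ r| ≤ 1 * |μ r| := by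
      rw [abs_mul]
      exact mul_le_mul_of_nonneg_right (abs_le.2 ⟨hr.1.le, hr.2.le⟩) (abs_nonneg _)
    have e3 := neg_abs_le (r * μ r)
    linarith [abs_nonneg (μ r)]

/-- Scalar nodes with a bounded drift and funnel coupling along the edges of a finite undirected
graph converge in finite time, and the limits lie strictly inside the funnels. -/
theorem exists_tendsto_of_funnelCoupling {V : Type*} [Fintype V] {adj : V → V → Prop}
    [DecidableRel adj] (hadj : ∀ i j, adj i j → adj j i) {a b B M : ℝ} (hab : a < b)
    {y F : V → ℝ → ℝ} {ψ ψ' : V → V → ℝ → ℝ} {μ : V → V → ℝ → ℝ}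
    (hy : ∀ i T, a ≤ T → T < b → AbsolutelyContinuousOnInterval (y i) a T)
    (hB : ∀ i t, a ≤ t → t < b → |y i t| ≤ B)
    (hF : ∀ i t, a ≤ t → t < b → |F i t| ≤ M)
    (hy' : ∀ i, ∀ᵐ t, a < t → t < b → HasDerivAt (y i)
      (F i t + ∑ j, if adj i j then μ i j ((y j t - y i t) / ψ i j t) else 0) t)
    (hfun : ∀ i j, adj i j → ∀ t, a ≤ t → t < b → |y j t - y i t| < ψ i j t)
    (hψ : ∀ i j, adj i j → AbsolutelyContinuousOnInterval (ψ i j) a b)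
    (hψ' : ∀ i j, adj i j → ∀ t, a < t → t < b → HasDerivAt (ψ i j) (ψ' i j t) t)
    (hψL : ∀ i j, adj i j → ∃ L, ∀ t, a < t → t < b → |ψ' i j t| ≤ L)
    (hψpos : ∀ i j, adj i j → ∀ t ∈ Icc a b, 0 < ψ i j t)
    (hψsymm : ∀ i j, adj i j → ∀ t ∈ Icc a b, ψ i j t = ψ j i t)
    (hμc : ∀ i j, adj i j → ContinuousOn (μ i j) (Ioo (-1) 1))
    (hμtop : ∀ i j, adj i j → Tendsto (μ i j) (𝓝[<] 1) atTop)
    (hμbot : ∀ i j, adj i j → Tendsto (μ i j) (𝓝[>] (-1)) atBot)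
    (hμsymm : ∀ i j, adj i j → ∀ r ∈ Ioo (-1 : ℝ) 1, μ i j (-r) = -μ j i r) :
    ∃ ys : V → ℝ, (∀ i, Tendsto (y i) (𝓝[<] b) (𝓝 (ys i))) ∧
      ∀ i j, adj i j → |ys j - ys i| < ψ i j b := by
  classical
  set g : V → V → ℝ → ℝ := fun i j t =>
    if adj i j then μ i j ((y j t - y i t) / ψ i j t) else 0 with hgdef
  have hIcc : ∀ t, a ≤ t → t < b → t ∈ Icc a b := fun t h1 h2 => ⟨h1, h2.le⟩
  have hratio : ∀ i j, adj i j → ∀ t, a ≤ t → t < b →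
      (y j t - y i t) / ψ i j t ∈ Ioo (-1 : ℝ) 1 := by
    intro i j h t h1 h2
    have hp := hψpos i j h t (hIcc t h1 h2)
    obtain ⟨e1, e2⟩ := abs_lt.1 (hfun i j h t h1 h2)
    exact ⟨by rw [lt_div_iff₀ hp]; linarith, by rw [div_lt_iff₀ hp]; linarith⟩
  have hg : ∀ i j t, a ≤ t → t < b → g i j t = -g j i t := by
    intro i j t h1 h2
    by_cases h : adj i j
    · have h' := hadj i j h
      simp only [hgdef, h, h', if_true]
      rw [← hμsymm i j h _ (hratio j i h' t h1 h2), hψsymm i j h t (hIcc t h1 h2), ← neg_div,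
        neg_sub]
    · have h' : ¬adj j i := fun h' => h (hadj j i h')
      simp [hgdef, h, h']
  have hψc : ∀ i j, adj i j → ContinuousOn (ψ i j) (Icc a b) := fun i j h => by
    simpa [uIcc_of_le hab.le] using (hψ i j h).continuousOn
  -- The dissipativity bound is in terms of the ratio r; multiplying by ψ turns it into one for the
  -- difference y_j - y_i, and a common positive lower bound κ of all ψ on [a, b] keeps the
  -- coefficient uniform.
  have hκ : ∃ κ : ℝ, 0 < κ ∧ ∀ i j, adj i j → ∀ t ∈ Icc a b, κ ≤ ψ i j t := by
    have h1 : ∀ p : V × V, ∀ᶠ κ in 𝓝[>] (0 : ℝ), adj p.1 p.2 → ∀ t ∈ Icc a b, κ ≤ ψ p.1 p.2 t := by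
      intro p
      by_cases h : adj p.1 p.2
      · obtain ⟨t₁, ht₁, hmin⟩ := isCompact_Icc.exists_isMinOn (nonempty_Icc.2 hab.le) (hψc _ _ h)
        filter_upwards [Ioo_mem_nhdsGT (hψpos _ _ h t₁ ht₁)] with κ hκ _ t ht
        exact hκ.2.le.trans (hmin ht)
      · exact Eventually.of_forall fun κ h' => (h h').elim
    obtain ⟨κ, hκ, hpos⟩ := ((eventually_all.2 h1).and self_mem_nhdsWithin).exists
    exact ⟨κ, hpos, fun i j => hκ (i, j)⟩
  obtain ⟨κ, hκpos, hκ⟩ := hκ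
  have hdiss : ∀ p : V × V, ∃ C, 0 ≤ C ∧ ∀ t, a ≤ t → t < b →
      κ / 2 * |g p.1 p.2 t| ≤ (y p.2 t - y p.1 t) * g p.1 p.2 t + C := by
    intro p
    by_cases h : adj p.1 p.2
    · obtain ⟨C, hC0, hC⟩ := exists_dissipativity_bound (hμc _ _ h) (hμtop _ _ h) (hμbot _ _ h)
      obtain ⟨P, hP⟩ := isCompact_Icc.exists_bound_of_continuousOn (hψc _ _ h)
      refine ⟨|P| * C, by positivity, fun t h1 h2 => ?_⟩
      have hp := hψpos _ _ h t (hIcc t h1 h2)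
      have e1 := hC _ (hratio _ _ h t h1 h2)
      have e2 := hκ _ _ h t (hIcc t h1 h2)
      have e3 : ψ p.1 p.2 t ≤ |P| :=
        (Real.le_norm_self _).trans ((hP t (hIcc t h1 h2)).trans (le_abs_self P))
      have e4 : y p.2 t - y p.1 t = ψ p.1 p.2 t * ((y p.2 t - y p.1 t) / ψ p.1 p.2 t) := by
        field_simp
      simp only [hgdef, h, if_true]
      set r := (y p.2 t - y p.1 t) / ψ p.1 p.2 t
      rw [e4]
      have e5 := mul_le_mul_of_nonneg_left e1 hp.le
      have e6 := mul_le_mul_of_nonneg_right e2 (abs_nonneg (μ p.1 p.2 r))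
      have e7 := mul_le_mul_of_nonneg_right e3 hC0
      linarith
    · exact ⟨0, le_rfl, by simp [hgdef, h]⟩
  choose C hC0 hC using hdiss
  obtain ⟨ys, hys⟩ := exists_tendsto_of_dissipative (κ := κ / 2) (C := ∑ p, C p) hab hy hB hF hy'
    hg (by positivity) (fun i j t h1 h2 => (hC (i, j) t h1 h2).trans (add_le_add_right
      (Finset.single_le_sum (f := C) (fun p _ => hC0 p) (Finset.mem_univ (i, j))) _))
  have hψlim : ∀ i j, adj i j → Tendsto (ψ i j) (𝓝[<] b) (𝓝 (ψ i j b)) := fun i j h =>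
    ((hψc i j h) b (right_mem_Icc.2 hab.le)).mono_left (by
      rw [nhdsWithin_le_iff]
      exact mem_of_superset (Ioo_mem_nhdsLT hab) Ioo_subset_Icc_self)
  have hnhds : ∀ᶠ t in 𝓝[<] b, a < t ∧ t < b := Ioo_mem_nhdsLT hab
  have hle : ∀ i j, adj i j → |ys j - ys i| ≤ ψ i j b := fun i j h =>
    le_of_tendsto_of_tendsto ((hys j).sub (hys i)).abs (hψlim i j h) (by
      filter_upwards [hnhds] with t ht using (hfun i j h t ht.1.le ht.2).le)
  have hrlim : ∀ i j, adj i j → Tendsto (fun t => (y j t - y i t) / ψ i j t) (𝓝[<] b)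
      (𝓝 ((ys j - ys i) / ψ i j b)) := fun i j h =>
    ((hys j).sub (hys i)).div (hψlim i j h) (hψpos i j h b (right_mem_Icc.2 hab.le)).ne'
  -- The edges that touch the boundary at time b, oriented from the higher to the lower end point:
  -- there the ratio tends to -1 and the coupling to -∞.
  let K : Finset (V × V) := {e | adj e.1 e.2 ∧ ys e.1 - ys e.2 = ψ e.1 e.2 b}
  have hKmem : ∀ e, e ∈ K ↔ adj e.1 e.2 ∧ ys e.1 - ys e.2 = ψ e.1 e.2 b := fun e => by simp [K]
  have hb : b ∈ Icc a b := right_mem_Icc.2 hab.le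
  have hstrict : ∀ i j, adj i j → (i, j) ∉ K → (j, i) ∉ K → |ys j - ys i| < ψ i j b := by
    intro i j h h1 h2
    rw [hKmem] at h1 h2
    refine lt_of_le_of_ne (hle i j h) fun heq => ?_
    rcases abs_cases (ys j - ys i) with hc | hc
    · exact h2 ⟨hadj i j h, by rw [← hψsymm i j h b hb, ← heq, hc.1]⟩
    · exact h1 ⟨h, by rw [← heq, hc.1]; ring⟩
  have hKempty : K = ∅ := by
    by_contra hne
    choose! L hL using hψL
    refine not_all_barriers_attained (K := K) (Finset.nonempty_iff_ne_empty.2 hne)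
      (ψ := fun e => ψ e.1 e.2) (ψ' := fun e => ψ' e.1 e.2) (L := ∑ e : V × V, |L e.1 e.2|)
      hab hy hF hy' hg hys ?_ ?_ ?_ ?_ ?_ ?_ ?_ ?_
    · intro e he T h1 h2
      refine (hψ _ _ ((hKmem e).1 he).1).mono ?_
      rw [uIcc_of_le h1, uIcc_of_le hab.le]
      exact Icc_subset_Icc_right h2.le
    · exact fun e he => hψ' _ _ ((hKmem e).1 he).1
    · intro e he t h1 h2
      exact (hL _ _ ((hKmem e).1 he).1 t h1 h2).trans ((le_abs_self _).trans
        (Finset.single_le_sum (f := fun e : V × V => |L e.1 e.2|) (fun _ _ => abs_nonneg _)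
          (Finset.mem_univ e)))
    · intro e he t h1 h2
      have := hfun _ _ ((hKmem e).1 he).1 t h1 h2
      rw [abs_sub_comm] at this
      exact (le_abs_self _).trans this.le
    · intro e he
      obtain ⟨h1, h2⟩ := (hKmem e).1 he
      have := hψpos _ _ h1 b hb
      linarith
    · intro e he
      obtain ⟨h1, h2⟩ := (hKmem e).1 he
      rw [h2]
      exact hψlim _ _ h1
    · intro e he
      obtain ⟨h1, h2⟩ := (hKmem e).1 he
      have hr : Tendsto (fun t => (y e.2 t - y e.1 t) / ψ e.1 e.2 t) (𝓝[<] b) (𝓝[>] (-1)) := by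
        refine tendsto_nhdsWithin_iff.2 ⟨?_, ?_⟩
        · have h3 := hrlim _ _ h1
          have h4 : (ys e.2 - ys e.1) / ψ e.1 e.2 b = -1 := by
            rw [← h2, ← neg_sub (ys e.1), neg_div, div_self]
            rw [h2]
            exact (hψpos _ _ h1 b hb).ne'
          rwa [h4] at h3
        · filter_upwards [hnhds] with t ht
          exact (hratio _ _ h1 t ht.1.le ht.2).1
      exact ((hμbot _ _ h1).comp hr).congr fun t => by simp [h1]
    · intro i j h1 h2
      by_cases h : adj i j
      · have hs := hstrict i j h h1 h2
        have hp := hψpos i j h b hb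
        have hmem : (ys j - ys i) / ψ i j b ∈ Ioo (-1 : ℝ) 1 := by
          obtain ⟨e1, e2⟩ := abs_lt.1 hs
          exact ⟨by rw [lt_div_iff₀ hp]; linarith, by rw [div_lt_iff₀ hp]; linarith⟩
        have hlim := (((hμc i j h).continuousAt (isOpen_Ioo.mem_nhds hmem)).tendsto.comp
          (hrlim i j h)).abs
        refine ⟨|μ i j ((ys j - ys i) / ψ i j b)| + 1,
          (hlim.eventually (gt_mem_nhds (lt_add_one _))).mono fun t ht => ?_⟩
        simpa [h] using ht.le
      · exact ⟨0, by simp [h]⟩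
  exact ⟨ys, hys, fun i j h => hstrict i j h (by simp [hKempty]) (by simp [hKempty])⟩

theorem aestronglyMeasurable_pi {ι α : Type*} [Fintype ι] [MeasurableSpace α] {μ : Measure α}
    {E : ι → Type*} [∀ i, NormedAddCommGroup (E i)] {f : α → ∀ i, E i}
    (hf : ∀ i, AEStronglyMeasurable (fun a => f a i) μ) : AEStronglyMeasurable f μ := by
  classical
  have : f = fun a => ∑ i, Pi.single i (f a i) := by
    funext a
    exact (Finset.univ_sum_single (f a)).symm
  rw [this]
  exact Finset.aestronglyMeasurable_fun_sum _ fun i _ =>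
    (continuous_single i).comp_aestronglyMeasurable (hf i)

namespace Network

variable {N m : ℕ} {n d : Fin N → ℕ} {S : Network N m n d} {t₀ : ℝ}

/-! ### Synchronization bound -/

theorem DesignFunctions.maxFunnel_nonneg (h : S.DesignFunctions t₀) {t : ℝ} (ht : t₀ ≤ t) :
    0 ≤ S.maxFunnel t :=
  Real.iSup_nonneg fun q => (h.ψ_pos _ _ q.2.adj q.1 t ht).le

theorem DesignFunctions.syncBound_nonneg (h : S.DesignFunctions t₀) {t : ℝ} (ht : t₀ ≤ t) :
    0 ≤ S.syncBound t :=
  mul_nonneg (Nat.cast_nonneg _) (h.maxFunnel_nonneg ht)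

theorem DesignFunctions.exists_syncBound_le (h : S.DesignFunctions t₀) :
    ∃ C, 0 ≤ C ∧ ∀ t, t₀ ≤ t → S.syncBound t ≤ C := by
  classical
  choose C hC using fun q : Fin m × S.graph.Dart => h.ψ_bounded _ _ q.2.adj q.1
  refine ⟨S.graph.diam * ∑ q, |C q|, mul_nonneg (Nat.cast_nonneg _)
    (Finset.sum_nonneg fun _ _ => abs_nonneg _), fun t ht => ?_⟩
  refine mul_le_mul_of_nonneg_left (Real.iSup_le (fun q => ?_)
    (Finset.sum_nonneg fun _ _ => abs_nonneg _)) (Nat.cast_nonneg _)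
  exact ((hC q t ht).trans (le_abs_self _)).trans
    (Finset.single_le_sum (f := fun q => |C q|) (fun _ _ => abs_nonneg _) (Finset.mem_univ q))

theorem psi_le_maxFunnel {i j : Fin N} (h : S.graph.Adj i j) (p : Fin m) (t : ℝ) :
    S.ψ i j p t ≤ S.maxFunnel t := by
  classical
  exact le_ciSup (f := fun q : Fin m × S.graph.Dart => S.ψ q.2.fst q.2.snd q.1 t)
    (Set.finite_range _).bddAbove (p, ⟨(i, j), h⟩)

/-- Along a shortest walk each edge contributes at most Ψ(t), and its length is at most the
diameter. -/
theorem norm_sub_le_syncBound (hG : S.graph.Connected) (hΨ : S.DesignFunctions t₀) {t : ℝ}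
    (ht : t₀ ≤ t) {x : State m n} (hx : (t, x) ∈ S.funnel) (i j : Fin N) :
    ‖(x i).1 - (x j).1‖ ≤ S.syncBound t := by
  have := hG.nonempty
  have hwalk : ∀ {i j : Fin N} (q : S.graph.Walk i j) (p : Fin m),
      |(x i).1 p - (x j).1 p| ≤ q.length * S.maxFunnel t := by
    intro i j q p
    induction q with
    | nil => simp
    | @cons u v w h q ih =>
      have h1 := (hx v u h.symm p).le.trans (psi_le_maxFunnel h.symm p t)
      have h2 := abs_sub_le ((x u).1 p) ((x v).1 p) ((x w).1 p)
      rw [SimpleGraph.Walk.length_cons]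
      push_cast
      linarith
  refine (pi_norm_le_iff_of_nonneg (hΨ.syncBound_nonneg ht)).2 fun p => ?_
  obtain ⟨q, hq⟩ := hG.exists_walk_length_eq_dist i j
  refine (hwalk q p).trans ?_
  rw [hq]
  refine mul_le_mul_of_nonneg_right ?_ (hΨ.maxFunnel_nonneg ht)
  exact_mod_cast SimpleGraph.dist_le_diam (SimpleGraph.connected_iff_ediam_ne_top.1 hG)

theorem norm_sub_blendedInit_le (hG : S.graph.Connected) (hΨ : S.DesignFunctions t₀) {t : ℝ}
    (ht : t₀ ≤ t) {x : State m n} (hx : (t, x) ∈ S.funnel) (i : Fin N) :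
    ‖(x i).1 - (blendedInit x).1‖ ≤ S.syncBound t := by
  have := hG.nonempty
  have hN : (N : ℝ) ≠ 0 := by
    have : NeZero N := ⟨fun h => by subst h; exact i.elim0⟩
    exact_mod_cast this.ne
  have h1 : (x i).1 - (blendedInit x).1 = (N : ℝ)⁻¹ • ∑ j, ((x i).1 - (x j).1) := by
    simp only [blendedInit, Finset.sum_sub_distrib, smul_sub, Finset.sum_const, Finset.card_univ,
      Fintype.card_fin, ← Nat.cast_smul_eq_nsmul ℝ, smul_smul, inv_mul_cancel₀ hN, one_smul]
  rw [h1, norm_smul, norm_inv, Real.norm_natCast]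
  have h2 : ‖∑ j, ((x i).1 - (x j).1)‖ ≤ N * S.syncBound t := by
    refine (norm_sum_le_of_le _ fun j _ => norm_sub_le_syncBound hG hΨ ht hx i j).trans ?_
    simp
  calc (N : ℝ)⁻¹ * ‖∑ j, ((x i).1 - (x j).1)‖ ≤ (N : ℝ)⁻¹ * (N * S.syncBound t) := by gcongr
    _ = S.syncBound t := by rw [← mul_assoc, inv_mul_cancel₀ hN, one_mul]

/-! ### The closed loop -/

open Classical in
/-- The total coupling `∑_{j ∈ 𝒩ᵢ} uᵢⱼ(t, yⱼ - yᵢ)` which acts on the output of agent `i`. -/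
def outputCoupling (S : Network N m n d) (t : ℝ) (x : State m n) (i : Fin N) : Vec m :=
  ∑ j with S.graph.Adj i j, S.edgeCoupling i j t ((x j).1 - (x i).1)

open Classical in
theorem outputCoupling_apply (t : ℝ) (x : State m n) (i : Fin N) (p : Fin m) :
    S.outputCoupling t x i p = ∑ j, if S.graph.Adj i j then
      S.μ i j p (((x j).1 p - (x i).1 p) / S.ψ i j p t) else 0 := by
  rw [outputCoupling, Finset.sum_apply, Finset.sum_filter]
  rfl

theorem GainMatrix.closedLoop_eq (h : S.GainMatrix t₀) {t : ℝ} (ht : t₀ ≤ t) (x : State m n) :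
    S.closedLoop t x = fun i => (S.F i t (x i).1 (x i).2 + S.outputCoupling t x i,
      S.Z i t (x i).2 (x i).1) := by
  funext i
  rw [closedLoop, coupling, Matrix.mulVec_mulVec, Matrix.mul_nonsing_inv _
    ((Matrix.isUnit_iff_isUnit_det _).1 (h.isUnit i t ht _)), Matrix.one_mulVec]
  rfl

theorem DesignFunctions.ratio_mem (h : S.DesignFunctions t₀) {t : ℝ} (ht : t₀ ≤ t)
    {x : State m n} (hx : (t, x) ∈ S.funnel) {i j : Fin N} (hij : S.graph.Adj i j) (p : Fin m) :
    ((x j).1 p - (x i).1 p) / S.ψ i j p t ∈ Ioo (-1 : ℝ) 1 := by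
  have hp := h.ψ_pos i j hij p t ht
  obtain ⟨e1, e2⟩ := abs_lt.1 (hx i j hij p)
  exact ⟨by rw [lt_div_iff₀ hp]; linarith, by rw [div_lt_iff₀ hp]; linarith⟩

/-- Antisymmetry along edges: this is summation by parts with the constant potential 1, whose
differences vanish. -/
theorem DesignFunctions.sum_outputCoupling (h : S.DesignFunctions t₀) {t : ℝ} (ht : t₀ ≤ t)
    {x : State m n} (hx : (t, x) ∈ S.funnel) : ∑ i, S.outputCoupling t x i = 0 := by
  classical
  funext p
  rw [Finset.sum_apply]
  simp only [outputCoupling_apply]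
  have := sum_mul_sum_antisymm (g := fun i j => if S.graph.Adj i j then
      S.μ i j p (((x j).1 p - (x i).1 p) / S.ψ i j p t) else 0) (fun i j => by
    by_cases hij : S.graph.Adj i j
    · simp only [hij, hij.symm, if_true]
      rw [← h.μ_symm i j hij p _ (h.ratio_mem ht hx hij.symm p), h.ψ_symm i j hij p t ht, ← neg_div,
        neg_sub]
    · have hji : ¬S.graph.Adj j i := fun h => hij h.symm
      simp [hij, hji]) (fun _ => 1)
  simpa using this

/-- The reduction on which both global existence and the estimate rest: averaging removes the
coupling, and yᵢ = s + (yᵢ - s) shows the deviation from the mean as the input. -/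
theorem blendedInit_closedLoop (hΓ : S.GainMatrix t₀) (hΨ : S.DesignFunctions t₀) {t : ℝ}
    (ht : t₀ ≤ t) {x : State m n} (hx : (t, x) ∈ S.funnel) :
    blendedInit (S.closedLoop t x) =
      S.perturbedBlended t (blendedInit x) (fun i => (x i).1 - (blendedInit x).1) := by
  rw [hΓ.closedLoop_eq ht]
  simp only [blendedInit, perturbedBlended, Finset.sum_add_distrib, hΨ.sum_outputCoupling ht hx,
    add_zero, add_sub_cancel]

/-- The map `x ↦ ((1/N) ∑ yᵢ, z₁, …, z_N)` as a continuous linear map. -/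
def blendedInitCLM (m : ℕ) (n : Fin N → ℕ) : State m n →L[ℝ] BlendedState m n :=
  LinearMap.toContinuousLinearMap
    { toFun := blendedInit
      map_add' := fun x y => by
        simp only [blendedInit, Pi.add_apply, Prod.fst_add, Prod.snd_add, Finset.sum_add_distrib,
          smul_add]
        rfl
      map_smul' := fun c x => by
        simp only [blendedInit, Pi.smul_apply, Prod.smul_fst, Prod.smul_snd, ← Finset.smul_sum,
          smul_comm _ c]
        rfl }

theorem blendedInitCLM_apply (x : State m n) : blendedInitCLM m n x = blendedInit x := rfl

/-! ### Regularity of the closed loop -/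

theorem OpenLoop.exists_bound (h : S.OpenLoop t₀) (R : ℝ) : ∃ C, 0 ≤ C ∧
    ∀ i t, t₀ ≤ t → ∀ y z, ‖y‖ ≤ R → ‖z‖ ≤ R → ‖S.F i t y z‖ ≤ C ∧ ‖S.Z i t z y‖ ≤ C := by
  choose A hA using fun i => (h.F i).bounded _ (isCompact_closedBall 0 R)
  choose B hB using fun i => (h.Z i).bounded _ (isCompact_closedBall 0 R)
  refine ⟨∑ i, (|A i| + |B i|), Finset.sum_nonneg fun i _ => by positivity,
    fun i t ht y z hy hz => ?_⟩
  have hmem : (y, z) ∈ Metric.closedBall (0 : Vec m × Vec (n i)) R := by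
    rw [mem_closedBall_zero_iff]
    exact max_le hy hz
  have hle := Finset.single_le_sum (f := fun i => |A i| + |B i|) (fun i _ => by positivity)
    (Finset.mem_univ i)
  have h1 := hA i t ht _ hmem
  have h2 := hB i t ht _ hmem
  simp only at h1 h2 hle
  exact ⟨by linarith [le_abs_self (A i), abs_nonneg (B i)],
    by linarith [le_abs_self (B i), abs_nonneg (A i)]⟩

theorem DesignFunctions.continuousOn_outputCoupling (h : S.DesignFunctions t₀) :
    ContinuousOn (fun q : ℝ × State m n => S.outputCoupling q.1 q.2)
      {q | t₀ ≤ q.1 ∧ q ∈ S.funnel} := by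
  classical
  refine continuousOn_pi.2 fun i => continuousOn_pi.2 fun p => ?_
  simp only [outputCoupling_apply]
  refine continuousOn_finsetSum _ fun j _ => ?_
  by_cases hij : S.graph.Adj i j
  · simp only [hij, if_true]
    refine (h.μ_continuousOn i j hij p).comp (ContinuousOn.div ?_ ?_ ?_) ?_
    · exact Continuous.continuousOn (by fun_prop)
    · exact (h.ψ_contDiff i j hij p).continuousOn.comp continuousOn_fst fun q hq => hq.1
    · exact fun q hq => (h.ψ_pos i j hij p q.1 hq.1).ne'
    · exact fun q hq => h.ratio_mem hq.1 hq.2 hij p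
  · simp only [hij, if_false]
    exact continuousOn_const

theorem DesignFunctions.exists_closedBall_subset_funnel (h : S.DesignFunctions t₀) {b : ℝ}
    (hb : t₀ ≤ b) {ξ : State m n} (hξ : (b, ξ) ∈ S.funnel) :
    ∃ r > 0, ∀ t, t₀ ≤ t → |t - b| ≤ r → ∀ η ∈ Metric.closedBall ξ r, (t, η) ∈ S.funnel := by
  have hev : ∀ᶠ q in 𝓝[Ici t₀ ×ˢ univ] (b, ξ), q ∈ S.funnel := by
    simp only [funnel, mem_ofPred_eq, eventually_all]
    intro i j hij p
    have h1 : ContinuousWithinAt (fun q : ℝ × State m n => S.ψ i j p q.1) (Ici t₀ ×ˢ univ)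
        (b, ξ) := ((h.ψ_contDiff i j hij p).continuousOn.comp continuousOn_fst
          fun q hq => hq.1) (b, ξ) ⟨hb, mem_univ _⟩
    have h2 : Continuous fun q : ℝ × State m n => |(q.2 j).1 p - (q.2 i).1 p| := by fun_prop
    exact Filter.Tendsto.eventually_lt h2.continuousWithinAt.tendsto h1.tendsto (hξ i j hij p)
  obtain ⟨ε, hε, hsub⟩ := Metric.mem_nhdsWithin_iff.1 hev
  refine ⟨ε / 2, by positivity, fun t ht htb η hη => hsub ⟨?_, ht, mem_univ _⟩⟩
  rw [Metric.mem_ball, Prod.dist_eq]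
  refine max_lt ?_ ?_
  · rw [Real.dist_eq]; linarith
  · have := Metric.mem_closedBall.1 hη
    linarith

/-- A small ball around a point of the funnel stays in the funnel for nearby times, so the coupling
is continuous, hence bounded, on a compact set. Used both to start solutions and to control
derivatives as a solution approaches a finite end time. -/
theorem exists_closedBall_bound (hO : S.OpenLoop t₀) (hΓ : S.GainMatrix t₀)
    (hΨ : S.DesignFunctions t₀) {b : ℝ} (hb : t₀ ≤ b) {ξ : State m n} (hξ : (b, ξ) ∈ S.funnel) :
    ∃ r > 0, ∃ C, ∀ t, t₀ ≤ t → |t - b| ≤ r → ∀ η ∈ Metric.closedBall ξ r,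
      (t, η) ∈ S.funnel ∧ ‖S.closedLoop t η‖ ≤ C := by
  obtain ⟨r, hr, hfun⟩ := hΨ.exists_closedBall_subset_funnel hb hξ
  have hK : IsCompact ((Icc (b - r) (b + r) ∩ Ici t₀) ×ˢ Metric.closedBall ξ r) :=
    (isCompact_Icc.inter_right isClosed_Ici).prod (isCompact_closedBall _ _)
  obtain ⟨C₁, hC₁⟩ := hK.exists_bound_of_continuousOn (hΨ.continuousOn_outputCoupling.mono (by
    rintro ⟨t, η⟩ ⟨⟨ht1, ht2⟩, hη⟩
    exact ⟨ht2, hfun t ht2 (abs_le.2 ⟨by linarith [ht1.1], by linarith [ht1.2]⟩) η hη⟩))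
  obtain ⟨C₂, hC₂, hFZ⟩ := hO.exists_bound (‖ξ‖ + r)
  refine ⟨r, hr, C₂ + |C₁|, fun t ht htb η hη => ⟨hfun t ht htb η hη, ?_⟩⟩
  have hG := (hC₁ (t, η) ⟨⟨⟨by linarith [(abs_le.1 htb).1], by linarith [(abs_le.1 htb).2]⟩, ht⟩,
    hη⟩).trans (le_abs_self _)
  have hηn : ‖η‖ ≤ ‖ξ‖ + r := by
    have := mem_closedBall_iff_norm.1 hη
    linarith [norm_le_norm_add_norm_sub' η ξ]
  rw [hΓ.closedLoop_eq ht]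
  refine (pi_norm_le_iff_of_nonneg (by positivity)).2 fun i => ?_
  obtain ⟨h1, h2⟩ := hFZ i t ht (η i).1 (η i).2
    ((norm_fst_le _).trans ((norm_le_pi_norm η i).trans hηn))
    ((norm_snd_le _).trans ((norm_le_pi_norm η i).trans hηn))
  have h3 := (norm_le_pi_norm (S.outputCoupling t η) i).trans hG
  exact max_le ((norm_add_le _ _).trans (add_le_add h1 h3)) (h2.trans (by
    linarith [abs_nonneg C₁]))

theorem exists_local_closedLoop_solution (hO : S.OpenLoop t₀) (hΓ : S.GainMatrix t₀)
    (hΨ : S.DesignFunctions t₀) {b : ℝ} (hb : t₀ ≤ b) {ξ : State m n} (hξ : (b, ξ) ∈ S.funnel) :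
    ∃ (c : ℝ) (x : ℝ → State m n), b < c ∧ x b = ξ ∧
      IsSolutionOn S.closedLoop S.funnel b c x := by
  obtain ⟨r, hr, C, hC⟩ := exists_closedBall_bound hO hΓ hΨ hb hξ
  have hIcc : ∀ t ∈ Icc b (b + r), t₀ ≤ t ∧ |t - b| ≤ r := fun t ht =>
    ⟨hb.trans ht.1, abs_le.2 ⟨by linarith [ht.1], by linarith [ht.2]⟩⟩
  refine exists_local_solution hr hr
    (fun t ht η hη => (hC t (hIcc t ht).1 (hIcc t ht).2 η hη).1)
    (fun t ht η hη => (hC t (hIcc t ht).1 (hIcc t ht).2 η hη).2) ?_ ?_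
  · intro t ht
    refine ContinuousOn.congr ?_ fun η _ => hΓ.closedLoop_eq (hIcc t ht).1 η
    refine continuousOn_pi.2 fun i => ContinuousOn.prodMk (ContinuousOn.add ?_ ?_) ?_
    · exact (((hO.F i).locallyLipschitz t (hIcc t ht).1).continuous.comp
        (continuous_apply i)).continuousOn
    · have hp : ContinuousOn (fun η : State m n => (t, η)) (Metric.closedBall ξ r) :=
        continuousOn_const.prodMk continuousOn_id
      exact continuousOn_pi.1 (ContinuousOn.comp
        (g := fun q : ℝ × State m n => S.outputCoupling q.1 q.2)
        hΨ.continuousOn_outputCoupling hp fun η hη => ⟨(hIcc t ht).1, (hC t (hIcc t ht).1 (hIcc t ht).2 η hη).1⟩) i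
    · exact (((hO.Z i).locallyLipschitz t (hIcc t ht).1).continuous.comp
        (continuous_apply i)).continuousOn
  · intro η hη
    have hle : volume.restrict (Icc b (b + r)) ≤ volume.restrict (Ici t₀) :=
      Measure.restrict_mono (fun t ht => (hIcc t ht).1) le_rfl
    have hG : AEStronglyMeasurable (fun t => S.outputCoupling t η)
        (volume.restrict (Icc b (b + r))) := by
      have hp : ContinuousOn (fun t : ℝ => (t, η)) (Icc b (b + r)) :=
        continuousOn_id.prodMk continuousOn_const
      exact (ContinuousOn.comp (g := fun q : ℝ × State m n => S.outputCoupling q.1 q.2)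
        hΨ.continuousOn_outputCoupling hp fun t ht => ⟨(hIcc t ht).1,
          (hC t (hIcc t ht).1 (hIcc t ht).2 η hη).1⟩).aestronglyMeasurable measurableSet_Icc
    have hrhs : AEStronglyMeasurable (fun t => (fun i => (S.F i t (η i).1 (η i).2 +
        S.outputCoupling t η i, S.Z i t (η i).2 (η i).1) : State m n))
        (volume.restrict (Icc b (b + r))) := by
      refine aestronglyMeasurable_pi fun i => ?_
      have hF := ((hO.F i).measurable (η i)).mono_measure hle
      have hZ := ((hO.Z i).measurable (η i)).mono_measure hle
      have hGi : AEStronglyMeasurable (fun t => S.outputCoupling t η i)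
          (volume.restrict (Icc b (b + r))) :=
        (continuous_apply (A := fun _ : Fin N => Vec m) i).comp_aestronglyMeasurable hG
      exact (hF.add hGi).prodMk hZ
    refine hrhs.congr ?_
    filter_upwards [ae_restrict_mem measurableSet_Icc] with t ht
    exact (hΓ.closedLoop_eq (hIcc t ht).1 η).symm

end Network

/-- A bounded derivative makes x Lipschitz near b, and the Lipschitz estimate survives the limit at
b. This supplies the closed end point needed to glue on a continuation. -/
theorem absolutelyContinuous_update_of_tendsto {X : Type*} [NormedAddCommGroup X]
    [NormedSpace ℝ X] {x x' : ℝ → X} {a b C : ℝ} {ξ : X} (hab : a < b)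
    (hx : ∀ T, a ≤ T → T < b → AbsolutelyContinuousOnInterval x a T)
    (hlim : Tendsto x (𝓝[<] b) (𝓝 ξ)) (hx' : ∀ᵐ t, a < t → t < b → HasDerivAt x (x' t) t)
    (hC : ∀ᶠ t in 𝓝[<] b, ‖x' t‖ ≤ C) :
    AbsolutelyContinuousOnInterval (Function.update x b ξ) a b := by
  obtain ⟨c, hc, hsub⟩ := (mem_nhdsLT_iff_exists_Ioo_subset' hab).1 hC
  obtain ⟨s, hs⟩ := nonempty_Ioo.2 (max_lt hc hab)
  have hcs : c < s := (le_max_left _ _).trans_lt hs.1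
  have has : a < s := (le_max_right _ _).trans_lt hs.1
  have hsb : s < b := hs.2
  have hest : ∀ p q, s ≤ p → p ≤ q → q < b → ‖x q - x p‖ ≤ C * (q - p) := by
    intro p q hp hpq hq
    refine norm_sub_le_of_ae_hasDerivAt (f' := x') hpq
      ((hx q (has.le.trans (hp.trans hpq)) hq).mono ?_) ?_ (Eventually.of_forall fun t ht =>
        hsub ⟨(hcs.trans_le hp).trans ht.1, ht.2.trans hq⟩)
    · rw [uIcc_of_le hpq, uIcc_of_le (has.le.trans (hp.trans hpq))]
      exact Icc_subset_Icc_left (has.le.trans hp)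
    · filter_upwards [hx'] with t ht htpq
      exact ht ((has.trans_le hp).trans htpq.1) (htpq.2.trans hq)
  have hest' : ∀ p, s ≤ p → p < b → ‖ξ - x p‖ ≤ C * (b - p) := by
    intro p hp hpb
    have h1 : Tendsto (fun q : ℝ => C * (q - p)) (𝓝[<] b) (𝓝 (C * (b - p))) :=
      (Continuous.tendsto (by fun_prop) b).mono_left nhdsWithin_le_nhds
    refine le_of_tendsto_of_tendsto (hlim.sub_const (x p)).norm h1 ?_
    filter_upwards [Ioo_mem_nhdsLT hpb] with q hq
    exact hest p q hp hq.1.le hq.2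
  have hLip : LipschitzOnWith C.toNNReal (Function.update x b ξ) (uIcc s b) := by
    have hle : ∀ p q, s ≤ p → p ≤ q → q ≤ b →
        ‖Function.update x b ξ q - Function.update x b ξ p‖ ≤ C * (q - p) := by
      intro p q hp hpq hq
      rcases hq.eq_or_lt with rfl | hq
      · rcases hpq.eq_or_lt with rfl | hpq
        · simp
        · rw [Function.update_self, Function.update_of_ne hpq.ne]
          exact hest' p hp hpq
      · rw [Function.update_of_ne hq.ne, Function.update_of_ne (hpq.trans_lt hq).ne]
        exact hest p q hp hpq hq
    rw [uIcc_of_le hsb.le]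
    refine LipschitzOnWith.of_dist_le_mul fun p hp q hq => ?_
    rw [Real.dist_eq, dist_eq_norm]
    rcases le_total p q with h | h
    · rw [norm_sub_rev, abs_sub_comm, abs_of_nonneg (sub_nonneg.2 h)]
      exact (hle p q hp.1 h hq.2).trans
        (mul_le_mul_of_nonneg_right (Real.le_coe_toNNReal C) (sub_nonneg.2 h))
    · rw [abs_of_nonneg (sub_nonneg.2 h)]
      exact (hle q p hq.1 h hp.2).trans
        (mul_le_mul_of_nonneg_right (Real.le_coe_toNNReal C) (sub_nonneg.2 h))
  have h1 : AbsolutelyContinuousOnInterval (Function.update x b ξ) a s := by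
    refine absolutelyContinuous_congr (hx s has.le hsb) fun t ht => ?_
    rw [uIcc_of_le has.le] at ht
    exact Function.update_of_ne (ht.2.trans_lt hsb).ne _ _
  refine absolutelyContinuous_congr (absolutelyContinuous_glue has.le hsb.le h1
    hLip.absolutelyContinuousOnInterval rfl) fun t _ => ?_
  simp

namespace Network

variable {N m : ℕ} {n d : Fin N → ℕ} {S : Network N m n d} {t₀ : ℝ}

/-! ### The synchronization error -/

open Classical in
/-- The deviations `eᵢ = yᵢ - s` from the mean `s` of the outputs on `[t₀, ω)`, extended by zero. -/
def syncError (t₀ : ℝ) (ω : EReal) (x : ℝ → State m n) (t : ℝ) : Fin N → Vec m :=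
  if t₀ ≤ t ∧ (t : EReal) < ω then fun i => (x t i).1 - (blendedInit (x t)).1 else 0

theorem norm_syncError_le (hG : S.graph.Connected) (hΨ : S.DesignFunctions t₀) {ω : EReal}
    {x : ℝ → State m n} (hx : IsSolutionOn S.closedLoop S.funnel t₀ ω x) {t : ℝ} (ht : t₀ ≤ t) :
    ‖syncError t₀ ω x t‖ ≤ S.syncBound t := by
  rw [syncError]
  split_ifs with h
  · exact (pi_norm_le_iff_of_nonneg (hΨ.syncBound_nonneg ht)).2
      (norm_sub_blendedInit_le hG hΨ ht (hx.mem_domain t h.1 h.2))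
  · simpa using hΨ.syncBound_nonneg ht

/-- The extension by zero is an input on all of [t₀, ∞) even when x lives only up to ω. A jump at ω
is harmless, as measurability and boundedness suffice. -/
theorem isAdmissibleInput_syncError (hG : S.graph.Connected) (hΨ : S.DesignFunctions t₀)
    {ω : EReal} {x : ℝ → State m n} (hx : IsSolutionOn S.closedLoop S.funnel t₀ ω x) :
    IsAdmissibleInput t₀ (syncError t₀ ω x) where
  measurable := by
    have hset : {t : ℝ | t₀ ≤ t ∧ (t : EReal) < ω} = Ici t₀ ∩ (fun t : ℝ => (t : EReal)) ⁻¹' Iio ω :=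
      rfl
    have hms : MeasurableSet {t : ℝ | t₀ ≤ t ∧ (t : EReal) < ω} := by
      rw [hset]
      exact measurableSet_Ici.inter (measurable_coe_real_ereal measurableSet_Iio)
    have hc : ContinuousOn x {t : ℝ | t₀ ≤ t ∧ (t : EReal) < ω} := by
      intro t ht
      obtain ⟨q, hq1, hq2⟩ := EReal.lt_iff_exists_real_btwn.1 ht.2
      have hq1 := EReal.coe_lt_coe_iff.1 hq1
      refine ((hx.continuousOn (ht.1.trans hq1.le) hq2) t ⟨ht.1, hq1.le⟩).mono_of_mem_nhdsWithin ?_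
      filter_upwards [self_mem_nhdsWithin, nhdsWithin_le_nhds (Iio_mem_nhds hq1)] with s h1 h2
      exact ⟨h1.1, (mem_Iio.1 h2).le⟩
    have hφ : Continuous fun ξ : State m n => fun i => (ξ i).1 - (blendedInit ξ).1 := by
      have := (blendedInitCLM m n).continuous
      simp only [← blendedInitCLM_apply]
      fun_prop
    have h1 := (hφ.comp_continuousOn hc).aestronglyMeasurable (μ := volume) hms
    have h2 := ((aestronglyMeasurable_indicator_iff hms).2 h1).mono_measure
      (Measure.restrict_le_self (s := Ici t₀))
    refine h2.congr (Eventually.of_forall fun t => ?_)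
    by_cases h : t₀ ≤ t ∧ (t : EReal) < ω
    · have hmem : t ∈ {t : ℝ | t₀ ≤ t ∧ (t : EReal) < ω} := h
      rw [indicator_of_mem hmem, syncError, if_pos h]
      rfl
    · have hmem : t ∉ {t : ℝ | t₀ ≤ t ∧ (t : EReal) < ω} := h
      rw [indicator_of_notMem hmem, syncError, if_neg h]
  locallyBounded T := by
    obtain ⟨C, -, hC⟩ := hΨ.exists_syncBound_le
    refine ⟨C, ?_⟩
    filter_upwards [ae_restrict_mem measurableSet_Icc] with t ht
    exact (norm_syncError_le hG hΨ hx ht.1).trans (hC t ht.1)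

theorem isSolutionOn_blendedInit (hΓ : S.GainMatrix t₀) (hΨ : S.DesignFunctions t₀) {ω : EReal}
    {x : ℝ → State m n} (hx : IsSolutionOn S.closedLoop S.funnel t₀ ω x) :
    IsSolutionOn (fun t ξ => S.perturbedBlended t ξ (syncError t₀ ω x t)) univ t₀ ω
      (fun t => blendedInit (x t)) where
  mem_domain _ _ _ := mem_univ _
  absolutelyContinuous T hT hlt :=
    absolutelyContinuous_comp_right (hx.absolutelyContinuous T hT hlt) (blendedInitCLM m n).lipschitz
  hasDerivAt := by
    filter_upwards [hx.hasDerivAt] with t ht h1 h2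
    have h3 := (blendedInitCLM m n).hasFDerivAt.comp_hasDerivAt t (ht h1 h2)
    have h4 : syncError t₀ ω x t = fun i => (x t i).1 - (blendedInit (x t)).1 := by
      rw [syncError, if_pos ⟨h1.le, h2⟩]
    rw [h4, ← blendedInit_closedLoop hΓ hΨ h1.le (hx.mem_domain t h1.le h2)]
    exact h3

theorem perturbedBlended_zero (t : ℝ) (ξ : BlendedState m n) :
    S.perturbedBlended t ξ 0 = S.blended t ξ := by
  simp [perturbedBlended, blended]

/-! ### Global existence -/

section Global

variable {β : ℝ → ℝ → ℝ} {γ : ℝ → ℝ}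

theorem exists_global_blended_solution (hISS : IsDeltaISS t₀ S.perturbedBlended β γ)
    (ξ₀ : BlendedState m n) :
    ∃ ξ, ξ t₀ = ξ₀ ∧ IsSolutionOn S.blended univ t₀ ⊤ ξ := by
  obtain ⟨ξ, h0, h⟩ := hISS.global t₀ le_rfl ξ₀ _ (isAdmissibleInput_zero t₀)
  exact ⟨ξ, h0, h.congr_rhs (fun _ _ _ => mem_univ _)
    fun t _ _ => (perturbedBlended_zero t (ξ t)).symm⟩

theorem isSolutionOn_perturbedBlended_zero {ω : EReal} {ξ : ℝ → BlendedState m n}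
    (h : IsSolutionOn S.blended univ t₀ ω ξ) :
    IsSolutionOn (fun t ξ => S.perturbedBlended t ξ 0) univ t₀ ω ξ :=
  h.congr_rhs (fun _ _ _ => mem_univ _) fun t _ _ => perturbedBlended_zero t (ξ t)

/-- By uniqueness the global solution with the same initial value extends the maximal one. -/
theorem blended_maximal_eq_top (hISS : IsDeltaISS t₀ S.perturbedBlended β γ) {ω : EReal}
    {ξ : ℝ → BlendedState m n} (h : IsMaximalSolution S.blended univ t₀ ω ξ) : ω = ⊤ := by
  obtain ⟨ξ', h0, h'⟩ := exists_global_blended_solution hISS (ξ t₀)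
  refine top_le_iff.1 (h.maximal ⊤ ξ' h' fun t ht hlt => ?_)
  exact (hISS.eq_of_isSolutionOn le_rfl (isAdmissibleInput_zero t₀)
    (isSolutionOn_perturbedBlended_zero h.isSolutionOn) (isSolutionOn_perturbedBlended_zero h')
    h0.symm ht hlt).symm

/-- Before a finite time `b`, a solution of the closed loop stays bounded, and its mean output and
its internal states converge. -/
theorem exists_bound_of_isSolutionOn (hΓ : S.GainMatrix t₀) (hG : S.graph.Connected)
    (hΨ : S.DesignFunctions t₀) (hISS : IsDeltaISS t₀ S.perturbedBlended β γ) {b : ℝ}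
    (hb : t₀ < b) {x : ℝ → State m n} (hx : IsSolutionOn S.closedLoop S.funnel t₀ b x) :
    ∃ R, (∀ t, t₀ ≤ t → t < b → ∀ i, ‖(x t i).1‖ ≤ R ∧ ‖(x t i).2‖ ≤ R) ∧
      ∃ zb : (i : Fin N) → Vec (n i), ∀ i, Tendsto (fun t => (x t i).2) (𝓝[<] b) (𝓝 (zb i)) := by
  have he := isAdmissibleInput_syncError hG hΨ hx
  have hs := isSolutionOn_blendedInit hΓ hΨ hx
  -- X exists beyond b and agrees with the averaged trajectory before b, so its continuity on [t₀,
  -- b] provides the bounds and the limits.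
  obtain ⟨X, hX0, hX⟩ := hISS.global t₀ le_rfl (blendedInit (x t₀)) _ he
  have heq : ∀ t, t₀ ≤ t → t < b → blendedInit (x t) = X t := fun t h1 h2 =>
    hISS.eq_of_isSolutionOn le_rfl he hs hX hX0.symm h1 (EReal.coe_lt_coe_iff.2 h2)
  have hc := hX.continuousOn hb.le (EReal.coe_lt_top b)
  obtain ⟨A, hA⟩ := isCompact_Icc.exists_bound_of_continuousOn hc
  obtain ⟨C, hC0, hC⟩ := hΨ.exists_syncBound_le
  refine ⟨A + C, fun t h1 h2 i => ?_, (X b).2, fun i => ?_⟩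
  · have e1 := hA t ⟨h1, h2.le⟩
    rw [← heq t h1 h2] at e1
    have e2 := (norm_sub_blendedInit_le hG hΨ h1
      (hx.mem_domain t h1 (EReal.coe_lt_coe_iff.2 h2)) i).trans (hC t h1)
    have e3 := (norm_fst_le (blendedInit (x t))).trans e1
    have e4 : ‖(x t i).2‖ ≤ A :=
      (norm_le_pi_norm (blendedInit (x t)).2 i).trans ((norm_snd_le _).trans e1)
    have e5 := norm_add_le ((x t i).1 - (blendedInit (x t)).1) (blendedInit (x t)).1
    rw [sub_add_cancel] at e5
    constructor <;> linarith
  · have hlim : Tendsto X (𝓝[<] b) (𝓝 (X b)) := (hc b (right_mem_Icc.2 hb.le)).mono_left (by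
      rw [nhdsWithin_le_iff]
      exact mem_of_superset (Ioo_mem_nhdsLT hb) Ioo_subset_Icc_self)
    have h2 := ((continuous_apply i).comp continuous_snd).continuousAt.tendsto.comp hlim
    refine h2.congr' ?_
    filter_upwards [Ioo_mem_nhdsLT hb] with t ht
    simp only [Function.comp_apply, ← heq t ht.1.le ht.2]
    rfl

/-- The `p`-th component of the output of agent `i` as a continuous linear functional. -/
def outputCLM (m : ℕ) (n : Fin N → ℕ) (i : Fin N) (p : Fin m) : State m n →L[ℝ] ℝ :=
  (ContinuousLinearMap.proj p).comp ((ContinuousLinearMap.fst ℝ (Vec m) (Vec (n i))).comp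
    (ContinuousLinearMap.proj i))

theorem outputCLM_apply (i : Fin N) (p : Fin m) (x : State m n) :
    outputCLM m n i p x = (x i).1 p := rfl

/-- Before a finite time `b`, the outputs converge, and the limits stay in the funnels. -/
theorem exists_limit_in_funnel (hO : S.OpenLoop t₀) (hΓ : S.GainMatrix t₀)
    (hG : S.graph.Connected) (hΨ : S.DesignFunctions t₀)
    (hISS : IsDeltaISS t₀ S.perturbedBlended β γ) {b : ℝ} (hb : t₀ < b) {x : ℝ → State m n}
    (hx : IsSolutionOn S.closedLoop S.funnel t₀ b x) :
    ∃ ξ, (b, ξ) ∈ S.funnel ∧ Tendsto x (𝓝[<] b) (𝓝 ξ) := by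
  classical
  obtain ⟨R, hR, zb, hz⟩ := exists_bound_of_isSolutionOn hΓ hG hΨ hISS hb hx
  obtain ⟨M, -, hM⟩ := hO.exists_bound R
  have hlim : ∀ p, ∃ ys : Fin N → ℝ,
      (∀ i, Tendsto (fun t => (x t i).1 p) (𝓝[<] b) (𝓝 (ys i))) ∧
      ∀ i j, S.graph.Adj i j → |ys j - ys i| < S.ψ i j p b := by
    intro p
    -- The coupling acts componentwise; once the states are known to be bounded, the remaining
    -- interaction of the components is hidden in the bounded drift F.
    refine exists_tendsto_of_funnelCoupling (adj := S.graph.Adj) (fun i j h => h.symm)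
      (y := fun i t => (x t i).1 p) (F := fun i t => S.F i t (x t i).1 (x t i).2 p)
      (ψ := fun i j => S.ψ i j p)
      (ψ' := fun i j => derivWithin (S.ψ i j p) (Ici t₀)) (μ := fun i j => S.μ i j p)
      (B := R) (M := M) hb ?_ ?_ ?_ ?_ ?_ ?_ ?_ ?_
      (fun i j h t ht => hΨ.ψ_pos i j h p t ht.1) (fun i j h t ht => hΨ.ψ_symm i j h p t ht.1)
      (fun i j h => hΨ.μ_continuousOn i j h p) (fun i j h => hΨ.μ_atTop i j h p)
      (fun i j h => hΨ.μ_atBot i j h p) (fun i j h => hΨ.μ_symm i j h p)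
    · intro i T h1 h2
      have := absolutelyContinuous_comp_right
        (hx.absolutelyContinuous T h1 (EReal.coe_lt_coe_iff.2 h2)) (outputCLM m n i p).lipschitz
      simpa only [outputCLM_apply] using this
    · exact fun i t h1 h2 => (norm_le_pi_norm (x t i).1 p).trans (hR t h1 h2 i).1
    · exact fun i t h1 h2 => (norm_le_pi_norm (S.F i t (x t i).1 (x t i).2) p).trans
        (hM i t h1 _ _ (hR t h1 h2 i).1 (hR t h1 h2 i).2).1
    · intro i
      filter_upwards [hx.hasDerivAt] with t ht h1 h2
      have h3 := (outputCLM m n i p).hasFDerivAt.comp_hasDerivAt t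
        (ht h1 (EReal.coe_lt_coe_iff.2 h2))
      rw [outputCLM_apply, hΓ.closedLoop_eq h1.le] at h3
      simp only [Pi.add_apply, outputCoupling_apply] at h3
      exact h3
    · exact fun i j h t h1 h2 => hx.mem_domain t h1 (EReal.coe_lt_coe_iff.2 h2) i j h p
    · intro i j h
      refine ((hΨ.ψ_contDiff i j h p).mono fun t ht => ?_).absolutelyContinuousOnInterval
      rw [uIcc_of_le hb.le] at ht
      exact ht.1
    · intro i j h t h1 _
      exact (((hΨ.ψ_contDiff i j h p).differentiableOn (by simp)) t
        h1.le).hasDerivWithinAt.hasDerivAt (Ici_mem_nhds h1)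
    · intro i j h
      obtain ⟨L, hL⟩ := hΨ.ψ_deriv_bounded i j h p
      exact ⟨L, fun t h1 _ => hL t h1.le⟩
  choose ys hys hysf using hlim
  refine ⟨fun i => (fun p => ys p i, zb i), fun i j h p => hysf p i j h, ?_⟩
  exact tendsto_pi_nhds.2 fun i => (tendsto_pi_nhds.2 fun p => hys p i).prodMk_nhds (hz i)

/-- At a finite end time b the state would converge to a point of the funnel, from which a new local
solution starts; gluing the two contradicts maximality. -/
theorem closedLoop_maximal_eq_top (hO : S.OpenLoop t₀) (hΓ : S.GainMatrix t₀)
    (hG : S.graph.Connected) (hΨ : S.DesignFunctions t₀)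
    (hISS : IsDeltaISS t₀ S.perturbedBlended β γ) {ω : EReal} {x : ℝ → State m n}
    (hmax : IsMaximalSolution S.closedLoop S.funnel t₀ ω x) : ω = ⊤ := by
  by_contra hω
  lift ω to ℝ using ⟨hω, (bot_le.trans_lt hmax.lt).ne'⟩ with b
  have hb : t₀ < b := EReal.coe_lt_coe_iff.1 hmax.lt
  have hx := hmax.isSolutionOn
  obtain ⟨ξ, hξ, hlim⟩ := exists_limit_in_funnel hO hΓ hG hΨ hISS hb hx
  obtain ⟨r, hr, C, hC⟩ := exists_closedBall_bound hO hΓ hΨ hb.le hξ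
  obtain ⟨c, y, hbc, hyb, hy⟩ := exists_local_closedLoop_solution hO hΓ hΨ hb.le hξ
  have hupd : ∀ t, t < b → Function.update x b ξ t = x t := fun t ht =>
    Function.update_of_ne ht.ne _ _
  have hac : AbsolutelyContinuousOnInterval (Function.update x b ξ) t₀ b := by
    refine absolutelyContinuous_update_of_tendsto (x' := fun t => S.closedLoop t (x t)) (C := C) hb
      (fun T h1 h2 => hx.absolutelyContinuous T h1 (EReal.coe_lt_coe_iff.2 h2)) hlim ?_ ?_
    · filter_upwards [hx.hasDerivAt] with t ht h1 h2
      exact ht h1 (EReal.coe_lt_coe_iff.2 h2)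
    · filter_upwards [hlim (Metric.closedBall_mem_nhds ξ hr), Ioo_mem_nhdsLT hb,
        Ioo_mem_nhdsLT (sub_lt_self b hr)] with t h1 h2 h3
      refine (hC t h2.1.le ?_ _ h1).2
      rw [abs_le]
      constructor <;> linarith [h3.1, h3.2]
  have hglue := IsSolutionOn.glue (f := S.closedLoop) (D := S.funnel) (x := Function.update x b ξ)
    hb.le
    (fun t h1 h2 => by rw [hupd t h2]; exact hx.mem_domain t h1 (EReal.coe_lt_coe_iff.2 h2)) hac
    (by
      filter_upwards [hx.hasDerivAt] with t ht h1 h2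
      rw [hupd t h2]
      refine (ht h1 (EReal.coe_lt_coe_iff.2 h2)).congr_of_eventuallyEq ?_
      filter_upwards [Iio_mem_nhds h2] with s hs
      exact hupd s hs) hy (by simp [hyb]) (EReal.coe_lt_coe_iff.2 hbc)
  refine hbc.not_ge (EReal.coe_le_coe_iff.1 (hmax.maximal c _ hglue fun t _ ht => ?_))
  have ht := EReal.coe_lt_coe_iff.1 ht
  simp only [ht.le, if_true, hupd t ht]

theorem exists_global_closedLoop_solution (hO : S.OpenLoop t₀) (hΓ : S.GainMatrix t₀)
    (hG : S.graph.Connected) (hΨ : S.DesignFunctions t₀)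
    (hISS : IsDeltaISS t₀ S.perturbedBlended β γ) {x₀ : State m n} (hx₀ : (t₀, x₀) ∈ S.funnel) :
    ∃ x, x t₀ = x₀ ∧ IsSolutionOn S.closedLoop S.funnel t₀ ⊤ x := by
  obtain ⟨c, y, hc, hy0, hy⟩ := exists_local_closedLoop_solution hO hΓ hΨ le_rfl hx₀
  obtain ⟨ω, x, hx0, hx⟩ := exists_isMaximalSolution (EReal.coe_lt_coe_iff.2 hc) hy
  have hω := closedLoop_maximal_eq_top hO hΓ hG hΨ hISS hx
  subst hω
  exact ⟨x, hx0.trans hy0, hx.isSolutionOn⟩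

end Global

end Network

end FunnelCoupling

end

/-! ### Distance to the blended dynamics -/

theorem corollary1 {N m : ℕ} {n d : Fin N → ℕ} (S : FunnelCoupling.Network N m n d) (t₀ : ℝ)
    (hOpen : S.OpenLoop t₀) (hGain : S.GainMatrix t₀) (hGraph : S.graph.Connected)
    (hDesign : S.DesignFunctions t₀) (hEscape : S.NoFiniteEscape t₀)
    (β : ℝ → ℝ → ℝ) (γhat : ℝ → ℝ)
    (hISS : FunnelCoupling.IsDeltaISS t₀ S.perturbedBlended β γhat)
    (w : ℝ → ℝ) (hw_anti : AntitoneOn w (Set.Ici 0))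
    (hw_mem : ∀ r, 0 ≤ r → w r ∈ Set.Ioc (0 : ℝ) 1)
    (hw_lim : Filter.Tendsto w Filter.atTop (nhds 0)) :
    ∃ γ : ℝ → ℝ, FunnelCoupling.ClassKInfty γ ∧
      ∀ x₀ : FunnelCoupling.Network.State m n, (t₀, x₀) ∈ S.funnel →
        -- global solutions of the closed loop and of the blended dynamics exist
        (∃ x, x t₀ = x₀ ∧ FunnelCoupling.IsSolutionOn S.closedLoop S.funnel t₀ ⊤ x) ∧
        (∃ ξ, ξ t₀ = FunnelCoupling.Network.blendedInit x₀ ∧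
          FunnelCoupling.IsSolutionOn S.blended Set.univ t₀ ⊤ ξ) ∧
        -- all maximal solutions are global and satisfy the estimate
        ∀ (ω : EReal) (x : ℝ → FunnelCoupling.Network.State m n)
          (ωhat : EReal) (ξ : ℝ → FunnelCoupling.Network.BlendedState m n),
          x t₀ = x₀ →
          FunnelCoupling.IsMaximalSolution S.closedLoop S.funnel t₀ ω x →
          ξ t₀ = FunnelCoupling.Network.blendedInit x₀ →
          FunnelCoupling.IsMaximalSolution S.blended Set.univ t₀ ωhat ξ →
          ω = ⊤ ∧ ωhat = ⊤ ∧
          ∀ (i : Fin N) (t : ℝ), t₀ ≤ t →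
            ‖x t i - ((ξ t).1, (ξ t).2 i)‖ ≤
              γ (⨆ s : Set.Ico t₀ t, S.syncBound s * w (t - s)) + S.syncBound t := by
  open FunnelCoupling FunnelCoupling.Network in
  obtain ⟨C, hC0, hC⟩ := hDesign.exists_syncBound_le
  obtain ⟨γ, hγ, hest⟩ := hISS.fading_memory hw_anti hw_mem hC0
  refine ⟨γ, hγ, fun x₀ hx₀ => ⟨exists_global_closedLoop_solution hOpen hGain hGraph hDesign hISS
    hx₀, exists_global_blended_solution hISS _, fun ω x ωhat ξ hx0 hx hξ0 hξ => ?_⟩⟩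
  have hω := closedLoop_maximal_eq_top hOpen hGain hGraph hDesign hISS hx
  have hωhat := blended_maximal_eq_top hISS hξ
  subst hω hωhat
  refine ⟨rfl, rfl, fun i t ht => ?_⟩
  have hxs := hx.isSolutionOn
  -- Both trajectories solve the perturbed blended dynamics from the same initial state, with inputs
  -- the synchronization error and 0, which differ by at most `S.syncBound`.
  have h1 : ‖blendedInit (x t) - ξ t‖ ≤ γ (⨆ s : Set.Ico t₀ t, S.syncBound s * w (t - s)) :=
    hest S.syncBound (fun _ => 0) (syncError t₀ ⊤ x) ξ (fun t => blendedInit (x t)) hC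
      (isAdmissibleInput_zero t₀) (isAdmissibleInput_syncError hGraph hDesign hxs)
      (fun s hs => by simpa using norm_syncError_le hGraph hDesign hxs hs)
      (isSolutionOn_perturbedBlended_zero hξ.isSolutionOn)
      (isSolutionOn_blendedInit hGain hDesign hxs) (by rw [hx0, hξ0]) t ht
  have h2 := norm_sub_blendedInit_le hGraph hDesign ht
    (hxs.mem_domain t ht (EReal.coe_lt_top t)) i
  have h3 : ‖(blendedInit (x t)).1 - (ξ t).1‖ ≤ _ := (norm_fst_le _).trans h1
  have h4 : ‖(x t i).2 - (ξ t).2 i‖ ≤ _ :=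
    (norm_le_pi_norm (blendedInit (x t) - ξ t).2 i).trans ((norm_snd_le _).trans h1)
  have h5 := norm_sub_le_norm_sub_add_norm_sub (x t i).1 (blendedInit (x t)).1 (ξ t).1
  refine max_le ?_ ?_
  · show ‖(x t i).1 - (ξ t).1‖ ≤ _
    linarith
  · show ‖(x t i).2 - (ξ t).2 i‖ ≤ _
    linarith [hDesign.syncBound_nonneg ht]
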